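/- **Theorem (convergence of the L1 graded-mesh / central-difference scheme).** Let $0<\alpha<1$, $\rho\ge 0$, $D,l,T>0$, $r\ge 1$ and $K\in\mathbb R$. For a function $v$ of time put $${}_0^CD_t^{(\alpha,\rho)}v(t)=\frac{e^{-\rho t}}{\Gamma(1-\alpha)}\int_0^t\frac{d(e^{\rho s}v(s))}{ds}\,\frac{ds}{(t-s)^{\alpha}} .$$ Let $u$ be a classical solution of the tempered time-fractional diffusion problem $${}_0^CD_t^{(\alpha,\rho)}u(x,t)=D\,\frac{\partial^2u}{\partial x^2}(x,t)+f(x,t),\quad x\in(0,l),\ t\in(0,T],$$ $$u(x,0)=\psi(x),\quad x\in[0,l],\qquad u(0,t)=u(l,t)=0,\quad t\in(0,T],$$ where $u(x,\cdot)$ is continuous on $[0,T]$ for each $x\in(0,l)$ and $u(\cdot,t)$ is continuous on $[0,l]$ for each $t\in(0,T]$. Suppose that $u(x,\cdot)\in C^2(0,T)$ for each $x\in(0,l)$, that $u(\cdot,t)\in C^4(0,l)$ for each $t\in(0,T]$, and that $$\Big|\frac{\partial^m u}{\partial t^m}(x,t)\Big|\le K(1+t^{\alpha-m})\quad(m=0,1,2;\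 0<x<l,\ 0<t<T),\qquad \Big|\frac{\partial^4u}{\partial x^4}(x,t)\Big|\le K\quad(0<x<l,\ 0<t\le T).$$ For integers $M,N\ge1$ let $h=l/M$, $x_i=ih$, $t_n=T(n/N)^r$, $\tau_n=t_n-t_{n-1}$, and let $(U_i^n)_{0\le i\le M,\,0\le n\le N}$ be a solution of the scheme $$\frac{1}{\Gamma(2-\alpha)}\sum_{k=0}^{n-1}\frac{e^{-\rho(t_n-t_{k+1})}U_i^{k+1}-e^{-\rho(t_n-t_k)}U_i^k}{\tau_{k+1}}\big[(t_n-t_k)^{1-\alpha}-(t_n-t_{k+1})^{1-\alpha}\big]=D\,\frac{U_{i-1}^n-2U_i^n+U_{i+1}^n}{h^2}+f(x_i,t_n)$$ for $1\le i\le M-1$, $1\le n\le N$, with $U_0^n=U_M^n=0$ for $1\le n\le N$ and $U_i^0=\psi(x_i)$ for $0\le i\le M$. Then there is a constant $C>0$, depending only on $\alpha,\rho,D,l,T,r,K$ (in particular not on $M$, $N$, $n$), such that for all $M,N\ge1$ and all $0\le n\le N$ $$\max_{0\le i\le M}|u(x_i,t_n)-U_i^n|\le C\big(h^2+T^\alpha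 N^{-\min\{2-\alpha,\,r\alpha\}}\big).$$ -/

import Mathlib

open Set

namespace TemperedDiffusion

/-- The Caputo tempered fractional derivative of order `α` with tempering parameter `ρ`,
`e^{-ρt} / Γ(1-α) * ∫₀ᵗ (e^{ρs} v(s))' (t-s)^{-α} ds`. -/
noncomputable def caputoTempered (α ρ : ℝ) (v : ℝ → ℝ) (t : ℝ) : ℝ :=
  Real.exp (-ρ * t) / Real.Gamma (1 - α) *
    ∫ s in (0 : ℝ)..t, deriv (fun s => Real.exp (ρ * s) * v s) s * (1 / (t - s) ^ α)

/-- `u` solves `D_t^{(α,ρ)} u = D u_xx + f` on `(0,l) × (0,T]`, with initial value `ψ` on `[0,l]`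
and zero boundary values on `(0,T]`, in the classical sense. -/
structure IsSolution (α ρ D l T : ℝ) (f : ℝ → ℝ → ℝ) (ψ : ℝ → ℝ) (u : ℝ → ℝ → ℝ) : Prop where
  continuousOn_time : ∀ x ∈ Ioo 0 l, ContinuousOn (fun t => u x t) (Icc 0 T)
  continuousOn_space : ∀ t ∈ Ioc 0 T, ContinuousOn (fun x => u x t) (Icc 0 l)
  equation : ∀ x ∈ Ioo 0 l, ∀ t ∈ Ioc 0 T,
    caputoTempered α ρ (fun s => u x s) t = D * iteratedDeriv 2 (fun y => u y t) x + f x t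
  initial : ∀ x ∈ Icc 0 l, u x 0 = ψ x
  boundary_left : ∀ t ∈ Ioc 0 T, u 0 t = 0
  boundary_right : ∀ t ∈ Ioc 0 T, u l t = 0

/-- Regularity of the solution with constant `K`: `|∂_t^m u| ≤ K (1 + t^{α-m})` for `m = 0, 1, 2`
(a weak singularity at `t = 0` is allowed) and `|∂_x^4 u| ≤ K`. -/
structure HasRegularity (α l T K : ℝ) (u : ℝ → ℝ → ℝ) : Prop where
  contDiffOn_time : ∀ x ∈ Ioo 0 l, ContDiffOn ℝ 2 (fun t => u x t) (Ioo 0 T)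
  bound_time : ∀ x ∈ Ioo 0 l, ∀ t ∈ Ioo 0 T, ∀ m : ℕ, m ≤ 2 →
    |iteratedDeriv m (fun s => u x s) t| ≤ K * (1 + t ^ (α - (m : ℝ)))
  contDiffOn_space : ∀ t ∈ Ioc 0 T, ContDiffOn ℝ 4 (fun x => u x t) (Ioo 0 l)
  bound_space : ∀ x ∈ Ioo 0 l, ∀ t ∈ Ioc 0 T, |iteratedDeriv 4 (fun y => u y t) x| ≤ K

/-- The graded temporal mesh `t_n = T (n/N)^r`. -/
noncomputable def gradedMesh (T r : ℝ) (N n : ℕ) : ℝ := T * ((n : ℝ) / (N : ℝ)) ^ r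

/-- The uniform spatial mesh `x_i = i h`, `h = l/M`. -/
noncomputable def uniformMesh (l : ℝ) (M i : ℕ) : ℝ := (i : ℝ) * (l / (M : ℝ))

/-- The L1 approximation, on the mesh `t`, of the Caputo tempered derivative at `t n` of a
function with nodal values `v`. The last summand, `k = n - 1`, is
`τ_n^{-α} (v n - e^{-ρ τ_n} v (n-1))`. -/
noncomputable def temperedL1 (α ρ : ℝ) (t v : ℕ → ℝ) (n : ℕ) : ℝ :=
  1 / Real.Gamma (2 - α) * ∑ k ∈ Finset.range n,
    (Real.exp (-ρ * (t n - t (k + 1))) * v (k + 1) - Real.exp (-ρ * (t n - t k)) * v k)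
      / (t (k + 1) - t k)
      * ((t n - t k) ^ (1 - α) - (t n - t (k + 1)) ^ (1 - α))

/-- The second-order central difference quotient at the node `i ≥ 1`. -/
noncomputable def centralDiff (h : ℝ) (v : ℕ → ℝ) (i : ℕ) : ℝ :=
  (v (i - 1) - 2 * v i + v (i + 1)) / h ^ 2

/-- `U n i` (time level `n ≤ N`, spatial node `i ≤ M`) solves the L1 / central difference scheme. -/
structure IsSchemeSolution (α ρ D l T r : ℝ) (M N : ℕ) (f : ℝ → ℝ → ℝ) (ψ : ℝ → ℝ)
    (U : ℕ → ℕ → ℝ) : Prop where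
  equation : ∀ n i : ℕ, 1 ≤ n → n ≤ N → 1 ≤ i → i + 1 ≤ M →
    temperedL1 α ρ (gradedMesh T r N) (fun k => U k i) n
      = D * centralDiff (l / (M : ℝ)) (U n) i + f (uniformMesh l M i) (gradedMesh T r N n)
  boundary_left : ∀ n : ℕ, 1 ≤ n → n ≤ N → U n 0 = 0
  boundary_right : ∀ n : ℕ, 1 ≤ n → n ≤ N → U n M = 0
  initial : ∀ i : ℕ, i ≤ M → U 0 i = ψ (uniformMesh l M i)

end TemperedDiffusion

/-! The proof is "stability plus consistency", with both halves measured in the weight `t n ^ (-α)`.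

Stability: on any mesh the L1 weights are positive and increase towards the current time, and the
oldest one is at least `(1 - α) * t n ^ (-α)`. Summation by parts then gives a discrete maximum
principle (`le_of_temperedL1_le`, `scheme_stability`): a residual of size `B * t n ^ (-α) / Γ(1-α)`
produces an error of at most `B`. The tempering factors are at most `1` and only help.

Consistency in time: for `v = e^{ρs} u`, L1 replaces `v'` by its slope on each mesh interval. On the
first interval `v'` is merely integrable, and the contribution is of order `t 1 ^ α`, hence `N ^
(-rα)`. On later intervals the deviation of `v'` from its slope has mean zero, so it is tested
against the variation of the kernel only. The grading makes `τ² t_k^{α-2}` at most a multiple of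
`T^α N^{-β} k^{-α}` with `β = min (2 - α) (r * α)`, and an Abel-type sum of kernel increments is
bounded uniformly in `n` (`sum_abs_integral_mesh_le`). Consistency in space is the classical `h²`
estimate, carried up to the boundary by continuity. -/

namespace TemperedDiffusion

open MeasureTheory

/-! ### Weights of the L1 formula and summation by parts -/

/-- The slopes of `s ↦ -(t n - s)^(1-α)` on the mesh intervals: the weights of the L1 formula. -/
noncomputable def l1Weight (α : ℝ) (t : ℕ → ℝ) (n k : ℕ) : ℝ :=
  ((t n - t k) ^ (1 - α) - (t n - t (k + 1)) ^ (1 - α)) / (t (k + 1) - t k)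

lemma temperedL1_eq_sum_l1Weight (α ρ : ℝ) (t v : ℕ → ℝ) (n : ℕ) :
    temperedL1 α ρ t v n = 1 / Real.Gamma (2 - α) * ∑ k ∈ Finset.range n,
      (Real.exp (-ρ * (t n - t (k + 1))) * v (k + 1) - Real.exp (-ρ * (t n - t k)) * v k)
        * l1Weight α t n k := by
  unfold temperedL1 l1Weight
  congr 1
  refine Finset.sum_congr rfl fun k _ => ?_
  ring

lemma temperedL1_sub (α ρ : ℝ) (t v w : ℕ → ℝ) (n : ℕ) :
    temperedL1 α ρ t (fun k => v k - w k) n = temperedL1 α ρ t v n - temperedL1 α ρ t w n := by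
  simp only [temperedL1_eq_sum_l1Weight]
  rw [← mul_sub, ← Finset.sum_sub_distrib]
  congr 1
  refine Finset.sum_congr rfl fun k _ => ?_
  ring

lemma temperedL1_neg (α ρ : ℝ) (t v : ℕ → ℝ) (n : ℕ) :
    temperedL1 α ρ t (fun k => -v k) n = -temperedL1 α ρ t v n := by
  simp only [temperedL1_eq_sum_l1Weight]
  rw [← mul_neg, ← Finset.sum_neg_distrib]
  congr 1
  refine Finset.sum_congr rfl fun k _ => ?_
  ring

lemma l1Weight_pos {α : ℝ} (hα1 : α < 1) {t : ℕ → ℝ} (ht : StrictMono t) {n k : ℕ} (hk : k < n) :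
    0 < l1Weight α t n k := by
  have h1 : t k < t (k + 1) := ht (Nat.lt_succ_self k)
  have h2 : t (k + 1) ≤ t n := ht.monotone hk
  refine div_pos (sub_pos.2 ?_) (by linarith)
  exact Real.rpow_lt_rpow (by linarith) (by linarith) (by linarith)

/-- The weights are adjacent chord slopes of the concave function `x ^ (1 - α)`, and these decrease
in `x = t n - t k`. -/
lemma l1Weight_le_succ {α : ℝ} (hα0 : 0 < α) (hα1 : α < 1) {t : ℕ → ℝ} (ht : StrictMono t)
    {n k : ℕ} (hk : k + 1 < n) : l1Weight α t n k ≤ l1Weight α t n (k + 1) := by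
  have h1 : t k < t (k + 1) := ht (Nat.lt_succ_self k)
  have h2 : t (k + 1) < t (k + 1 + 1) := ht (Nat.lt_succ_self _)
  have h3 : t (k + 1 + 1) ≤ t n := ht.monotone hk
  have hc := Real.concaveOn_rpow (p := 1 - α) (by linarith) (by linarith)
  have := hc.slope_anti_adjacent (x := t n - t (k + 1 + 1)) (y := t n - t (k + 1))
    (z := t n - t k) (by simp only [mem_Ici]; linarith) (by simp only [mem_Ici]; linarith)
    (by linarith) (by linarith)
  simpa [l1Weight] using this

/-- Bernoulli's inequality for the exponent `1 - α ≤ 1`. This lower bound is what produces the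
factor `t n ^ α` in the stability estimate. -/
lemma le_l1Weight_zero {α : ℝ} (hα0 : 0 < α) (hα1 : α < 1) {t : ℕ → ℝ} (ht : StrictMono t)
    (ht0 : t 0 = 0) {n : ℕ} (hn : 1 ≤ n) : (1 - α) * t n ^ (-α) ≤ l1Weight α t n 0 := by
  have h1 : 0 < t 1 := ht0 ▸ ht one_pos
  have h2 : t 1 ≤ t n := ht.monotone hn
  have hn0 : 0 < t n := h1.trans_le h2
  have hq : t 1 / t n ≤ 1 := (div_le_one hn0).2 h2
  have hB := rpow_one_add_le_one_add_mul_self (s := -(t 1 / t n)) (by linarith)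
    (p := 1 - α) (by linarith) (by linarith)
  have hs : (t n - t 1) ^ (1 - α) = t n ^ (1 - α) * (1 + -(t 1 / t n)) ^ (1 - α) := by
    rw [← Real.mul_rpow hn0.le (by linarith)]
    congr 1
    field_simp
    ring
  have hp : t n ^ (1 - α) = t n ^ (-α) * t n := by
    rw [← Real.rpow_add_one hn0.ne']
    congr 1
    ring
  unfold l1Weight
  simp only [ht0, sub_zero, zero_add]
  rw [le_div_iff₀ h1, hs]
  have := mul_le_mul_of_nonneg_left hB (Real.rpow_nonneg hn0.le (1 - α))
  have h4 : t n ^ (1 - α) * (1 + (1 - α) * -(t 1 / t n))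
      = t n ^ (1 - α) - (1 - α) * t n ^ (-α) * t 1 := by
    rw [hp]
    field_simp
    ring
  linarith

/-- After summation by parts, the interior terms `z k * (w k - w (k - 1))` are nonnegative and can
be dropped. The sign of the last value `z (m + 1)` stays free, since that is the value to be
estimated. -/
lemma le_sum_sub_mul_of_monotone_weight {z w : ℕ → ℝ} {m : ℕ}
    (hz : ∀ k, 1 ≤ k → k ≤ m → 0 ≤ z k) (hw : ∀ k, k + 1 ≤ m → w k ≤ w (k + 1)) :
    z 0 * w 0 - z (m + 1) * w m ≤ ∑ k ∈ Finset.range (m + 1), (z k - z (k + 1)) * w k := by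
  induction m with
  | zero => simp [sub_mul]
  | succ m ih =>
    rw [Finset.sum_range_succ]
    have h1 := ih (fun k h1 h2 => hz k h1 (by omega)) (fun k h => hw k (by omega))
    have h2 := mul_nonneg (hz (m + 1) (by omega) le_rfl) (sub_nonneg.2 (hw m le_rfl))
    linarith

lemma Gamma_two_sub {α : ℝ} (hα1 : α < 1) :
    Real.Gamma (2 - α) = (1 - α) * Real.Gamma (1 - α) := by
  rw [← Real.Gamma_add_one (by linarith : (1 : ℝ) - α ≠ 0)]
  congr 1
  ring

/-- If a grid function vanishes initially and is bounded by `B` up to the time level `n - 1`, then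
its value at level `n` is at most `B` as soon as its L1 derivative there is at most
`B * t_n^{-α} / Γ(1-α)`. -/
lemma le_of_temperedL1_le {α ρ : ℝ} (hα0 : 0 < α) (hα1 : α < 1) (hρ : 0 ≤ ρ) {t : ℕ → ℝ}
    (ht : StrictMono t) (ht0 : t 0 = 0) {v : ℕ → ℝ} {n : ℕ} (hn : 1 ≤ n) {B G : ℝ} (hB : 0 ≤ B)
    (hv0 : v 0 = 0) (hv : ∀ k < n, v k ≤ B) (hG : Real.Gamma (1 - α) * (t n ^ α * G) ≤ B)
    (hL : temperedL1 α ρ t v n ≤ G) : v n ≤ B := by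
  obtain ⟨m, rfl⟩ : ∃ m, n = m + 1 := ⟨n - 1, by omega⟩
  by_contra! hlt
  have hΓ : 0 < Real.Gamma (1 - α) := Real.Gamma_pos_of_pos (by linarith)
  have htn : 0 < t (m + 1) := ht0 ▸ ht (Nat.succ_pos m)
  -- The constant `B` cancels in differences of `z`, so the L1 sum is unchanged. For `k ≤ m`, `z k ≥
  -- 0` because the damping factor is at most `1` and `B ≥ 0`, whatever the sign of `v k`.
  set z : ℕ → ℝ := fun k => B - Real.exp (-ρ * (t (m + 1) - t k)) * v k with hz
  have hz0 : z 0 = B := by simp [hz, hv0]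
  have hzn : z (m + 1) = B - v (m + 1) := by simp [hz]
  have hzk : ∀ k, 1 ≤ k → k ≤ m → 0 ≤ z k := by
    intro k _ hk
    have h1 : t k ≤ t (m + 1) := ht.monotone (by omega)
    have h2 : Real.exp (-ρ * (t (m + 1) - t k)) ≤ 1 :=
      Real.exp_le_one_iff.2 (by nlinarith)
    have h3 := hv k (by omega)
    have h4 := Real.exp_pos (-ρ * (t (m + 1) - t k))
    simp only [hz]
    nlinarith
  have key := le_sum_sub_mul_of_monotone_weight (z := z) (w := l1Weight α t (m + 1)) hzk
    (fun k hk => l1Weight_le_succ hα0 hα1 ht (by omega))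
  have hsum : ∑ k ∈ Finset.range (m + 1), (z k - z (k + 1)) * l1Weight α t (m + 1) k
      = Real.Gamma (2 - α) * temperedL1 α ρ t v (m + 1) := by
    have : Real.Gamma (2 - α) ≠ 0 := (Real.Gamma_pos_of_pos (by linarith)).ne'
    rw [temperedL1_eq_sum_l1Weight, ← mul_assoc, mul_one_div_cancel this, one_mul]
    refine Finset.sum_congr rfl fun k _ => ?_
    simp only [hz]
    ring
  rw [hsum, hz0, hzn, Gamma_two_sub hα1] at key
  have hw := l1Weight_pos hα1 ht (n := m + 1) (Nat.lt_succ_self m)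
  have hw0 := mul_le_mul_of_nonneg_left (le_l1Weight_zero hα0 hα1 ht ht0 hn) hB
  have h1 := mul_le_mul_of_nonneg_left hL (mul_pos (sub_pos.2 hα1) hΓ).le
  have h2 : Real.Gamma (1 - α) * G ≤ B * t (m + 1) ^ (-α) := by
    have := mul_le_mul_of_nonneg_right hG (Real.rpow_nonneg htn.le (-α))
    have e : t (m + 1) ^ α * t (m + 1) ^ (-α) = 1 := by
      rw [← Real.rpow_add htn]; simp
    calc Real.Gamma (1 - α) * G
        = Real.Gamma (1 - α) * G * (t (m + 1) ^ α * t (m + 1) ^ (-α)) := by rw [e, mul_one]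
      _ = Real.Gamma (1 - α) * (t (m + 1) ^ α * G) * t (m + 1) ^ (-α) := by ring
      _ ≤ _ := this
  have h3 := mul_le_mul_of_nonneg_left h2 (sub_pos.2 hα1).le
  -- The lower bound on the oldest weight cancels `B * w 0` against the residual and leaves `(v (m +
  -- 1) - B) * w m ≤ 0`, contradicting this.
  have h4 : 0 < (v (m + 1) - B) * l1Weight α t (m + 1) m := mul_pos (by linarith) hw
  nlinarith

/-! ### Discrete maximum principle and stability -/

lemma centralDiff_nonpos_of_isMax {h : ℝ} {v : ℕ → ℝ} {i : ℕ} (h1 : v (i - 1) ≤ v i)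
    (h2 : v (i + 1) ≤ v i) : centralDiff h v i ≤ 0 :=
  div_nonpos_of_nonpos_of_nonneg (by linarith) (sq_nonneg h)

/-- One-sided discrete maximum principle, one time step. -/
lemma scheme_step_le {α ρ D h : ℝ} (hα0 : 0 < α) (hα1 : α < 1) (hρ : 0 ≤ ρ) (hD : 0 < D)
    {t : ℕ → ℝ} (ht : StrictMono t) (ht0 : t 0 = 0) {e : ℕ → ℕ → ℝ} {R : ℕ → ℝ} {M n : ℕ}
    {B G : ℝ} (hn : 1 ≤ n) (hB : 0 ≤ B)
    (heq : ∀ i, 1 ≤ i → i + 1 ≤ M →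
      temperedL1 α ρ t (fun k => e k i) n = D * centralDiff h (e n) i + R i)
    (hl : e n 0 = 0) (hr : e n M = 0) (h0 : ∀ i ≤ M, e 0 i = 0)
    (hR : ∀ i, 1 ≤ i → i + 1 ≤ M → R i ≤ G) (hG : Real.Gamma (1 - α) * (t n ^ α * G) ≤ B)
    (hprev : ∀ k < n, ∀ i ≤ M, e k i ≤ B) : ∀ i ≤ M, e n i ≤ B := by
  obtain ⟨j, hj, hmax⟩ := Finset.exists_max_image (Finset.range (M + 1)) (e n) ⟨0, by simp⟩
  have hj' : j ≤ M := Nat.lt_succ_iff.1 (Finset.mem_range.1 hj)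
  have hmax' : ∀ i ≤ M, e n i ≤ e n j := fun i hi => hmax i (by simp; omega)
  intro i hi
  refine (hmax' i hi).trans ?_
  rcases Nat.eq_zero_or_pos j with rfl | hjpos
  · rw [hl]; exact hB
  rcases hj'.eq_or_lt with rfl | hjlt
  · rw [hr]; exact hB
  refine le_of_temperedL1_le (v := fun k => e k j) hα0 hα1 hρ ht ht0 hn hB (h0 j hj')
    (fun k hk => hprev k hk j hj') hG ?_
  rw [heq j hjpos hjlt]
  have := centralDiff_nonpos_of_isMax (h := h) (hmax' (j - 1) (by omega)) (hmax' (j + 1) hjlt)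
  nlinarith [hR j hjpos hjlt]

/-- Stability of the scheme in the maximum norm. -/
lemma scheme_stability {α ρ D h : ℝ} (hα0 : 0 < α) (hα1 : α < 1) (hρ : 0 ≤ ρ) (hD : 0 < D)
    {t : ℕ → ℝ} (ht : StrictMono t) (ht0 : t 0 = 0) {e : ℕ → ℕ → ℝ} {R : ℕ → ℕ → ℝ} {M N : ℕ}
    {B : ℝ} {G : ℕ → ℝ} (hB : 0 ≤ B)
    (heq : ∀ n i, 1 ≤ n → n ≤ N → 1 ≤ i → i + 1 ≤ M →
      temperedL1 α ρ t (fun k => e k i) n = D * centralDiff h (e n) i + R n i)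
    (hl : ∀ n, 1 ≤ n → n ≤ N → e n 0 = 0) (hr : ∀ n, 1 ≤ n → n ≤ N → e n M = 0)
    (h0 : ∀ i ≤ M, e 0 i = 0)
    (hR : ∀ n i, 1 ≤ n → n ≤ N → 1 ≤ i → i + 1 ≤ M → |R n i| ≤ G n)
    (hG : ∀ n, 1 ≤ n → n ≤ N → Real.Gamma (1 - α) * (t n ^ α * G n) ≤ B) :
    ∀ n ≤ N, ∀ i ≤ M, |e n i| ≤ B := by
  intro n
  induction n using Nat.strong_induction_on with
  | _ n ih =>
    intro hnN i hi
    rcases Nat.eq_zero_or_pos n with rfl | hn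
    · rw [h0 i hi, abs_zero]; exact hB
    have hprev : ∀ k < n, ∀ i ≤ M, |e k i| ≤ B := fun k hk i hi => ih k hk (by omega) i hi
    refine abs_le.2 ⟨?_, ?_⟩
    -- The lower bound is the upper bound for `-e`, by linearity of the scheme.
    · have := scheme_step_le (e := fun n i => -e n i) (R := fun i => -R n i) (h := h) hα0 hα1 hρ hD
        ht ht0 hn hB (fun j h1 h2 => by
          rw [temperedL1_neg, heq n j hn hnN h1 h2]; unfold centralDiff; ring)
        (by simp [hl n hn hnN]) (by simp [hr n hn hnN]) (fun j hj => by simp [h0 j hj])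
        (fun j h1 h2 => (neg_le_abs _).trans (hR n j hn hnN h1 h2)) (hG n hn hnN)
        (fun k hk j hj => (neg_le_abs _).trans (hprev k hk j hj)) i hi
      linarith
    · exact scheme_step_le (e := e) (R := R n) (h := h) hα0 hα1 hρ hD
        ht ht0 hn hB (fun j h1 h2 => heq n j hn hnN h1 h2)
        (hl n hn hnN) (hr n hn hnN) h0
        (fun j h1 h2 => (le_abs_self _).trans (hR n j hn hnN h1 h2)) (hG n hn hnN)
        (fun k hk j hj => (le_abs_self _).trans (hprev k hk j hj)) i hi

/-! ### Consistency of the central difference -/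

lemma hasDerivAt_iteratedDeriv_of_contDiffOn {f : ℝ → ℝ} {s : Set ℝ} (hs : IsOpen s) {m : ℕ}
    {n : WithTop ℕ∞} (hf : ContDiffOn ℝ n f s) (hmn : (m : WithTop ℕ∞) < n) {x : ℝ} (hx : x ∈ s) :
    HasDerivAt (iteratedDeriv m f) (iteratedDeriv (m + 1) f x) x := by
  have hd : DifferentiableOn ℝ (iteratedDeriv m f) s :=
    (hf.differentiableOn_iteratedDerivWithin hmn hs.uniqueDiffOn).congr
      fun y hy => (iteratedDerivWithin_of_isOpen hs hy).symm
  rw [iteratedDeriv_succ]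
  exact (hd.differentiableAt (hs.mem_nhds hx)).hasDerivAt

/-- One integration step of the Taylor argument. The interval is half-open because `x ± h` may be
boundary points, where no derivative is available. -/
lemma abs_le_mul_of_hasDerivAt_Ico {g g' : ℝ → ℝ} {h C : ℝ} (h0 : g 0 = 0) (hC : 0 ≤ C)
    (hg : ∀ y ∈ Ico 0 h, HasDerivAt g (g' y) y) (hb : ∀ y ∈ Ico 0 h, |g' y| ≤ C) :
    ∀ y ∈ Ico 0 h, |g y| ≤ C * h := by
  intro y hy
  have := (convex_Ico (0 : ℝ) h).norm_image_sub_le_of_norm_hasDerivWithin_le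
    (fun z hz => (hg z hz).hasDerivWithinAt) hb ⟨le_rfl, hy.1.trans_lt hy.2⟩ hy
  rw [h0, sub_zero, sub_zero, Real.norm_eq_abs, Real.norm_eq_abs, abs_of_nonneg hy.1] at this
  exact this.trans (mul_le_mul_of_nonneg_left hy.2.le hC)

/-- Consistency of the central difference quotient, up to the boundary of the interval on which the
fourth derivative is bounded. -/
lemma abs_second_difference_sub_le {w : ℝ → ℝ} {l K x h : ℝ} (hK : 0 ≤ K) (hh : 0 < h)
    (hc : ContinuousOn w (Icc 0 l)) (hw : ContDiffOn ℝ 4 w (Ioo 0 l))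
    (hb : ∀ y ∈ Ioo 0 l, |iteratedDeriv 4 w y| ≤ K) (hx0 : 0 ≤ x - h) (hxl : x + h ≤ l) :
    |w (x + h) + w (x - h) - 2 * w x - h ^ 2 * iteratedDeriv 2 w x| ≤ 2 * K * h ^ 4 := by
  have hp : ∀ y ∈ Ico 0 h, x + y ∈ Ioo 0 l := fun y hy =>
    ⟨by linarith [hy.1], by linarith [hy.2]⟩
  have hm : ∀ y ∈ Ico 0 h, x - y ∈ Ioo 0 l := fun y hy =>
    ⟨by linarith [hy.2], by linarith [hy.1]⟩
  have hdp : ∀ m < 4, ∀ y ∈ Ico 0 h, HasDerivAt (fun y => iteratedDeriv m w (x + y))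
      (iteratedDeriv (m + 1) w (x + y)) y := fun m hm4 y hy =>
    (hasDerivAt_iteratedDeriv_of_contDiffOn isOpen_Ioo hw (by exact_mod_cast hm4) (hp y hy)).comp_const_add x y
  have hdm : ∀ m < 4, ∀ y ∈ Ico 0 h, HasDerivAt (fun y => iteratedDeriv m w (x - y))
      (-iteratedDeriv (m + 1) w (x - y)) y := fun m hm4 y hy =>
    (hasDerivAt_iteratedDeriv_of_contDiffOn isOpen_Ioo hw (by exact_mod_cast hm4) (hm y hy)).comp_const_sub x y
  -- Starting from `|w⁗| ≤ K`, the symmetric combinations in `y` are integrated four times from `0`;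
  -- each integration costs a factor `h`.
  have h3 := abs_le_mul_of_hasDerivAt_Ico
    (g := fun y => iteratedDeriv 3 w (x + y) - iteratedDeriv 3 w (x - y)) (h := h) (C := 2 * K)
    (by simp) (by positivity) (fun y hy => (hdp 3 (by norm_num) y hy).sub (hdm 3 (by norm_num) y hy))
    (fun y hy => by
      have h1 := abs_le.1 (hb _ (hp y hy))
      have h2 := abs_le.1 (hb _ (hm y hy))
      refine abs_le.2 ⟨?_, ?_⟩ <;> norm_num <;> linarith)
  have h2 := abs_le_mul_of_hasDerivAt_Ico
    (g := fun y => iteratedDeriv 2 w (x + y) + iteratedDeriv 2 w (x - y) - 2 * iteratedDeriv 2 w x)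
    (h := h) (C := 2 * K * h) (by simp only [add_zero, sub_zero]; ring) (by positivity)
    (fun y hy => ((hdp 2 (by norm_num) y hy).add (hdm 2 (by norm_num) y hy)).sub_const _)
    (fun y hy => by simpa [sub_eq_add_neg] using h3 y hy)
  have h1 := abs_le_mul_of_hasDerivAt_Ico
    (g := fun y => iteratedDeriv 1 w (x + y) - iteratedDeriv 1 w (x - y)
      - 2 * iteratedDeriv 2 w x * y)
    (h := h) (C := 2 * K * h * h) (by simp) (by positivity)
    (fun y hy => ((hdp 1 (by norm_num) y hy).sub (hdm 1 (by norm_num) y hy)).sub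
      ((hasDerivAt_id y).const_mul (2 * iteratedDeriv 2 w x)))
    (fun y hy => by simpa [sub_neg_eq_add] using h2 y hy)
  have h0 := abs_le_mul_of_hasDerivAt_Ico
    (g := fun y => iteratedDeriv 0 w (x + y) + iteratedDeriv 0 w (x - y)
      - 2 * w x - iteratedDeriv 2 w x * y ^ 2)
    (h := h) (C := 2 * K * h * h * h) (by simp; ring) (by positivity)
    (fun y hy => (((hdp 0 (by norm_num) y hy).add (hdm 0 (by norm_num) y hy)).sub_const _).sub
      ((hasDerivAt_pow 2 y).const_mul (iteratedDeriv 2 w x)))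
    (fun y hy => by
      have := h1 y hy
      convert this using 2
      norm_num
      ring)
  -- The bound passes to the endpoint `y = h` by continuity of `w` on the closed interval.
  have hcl : closure (Ico 0 h) = Icc 0 h := closure_Ico hh.ne
  have hcont : ContinuousOn (fun y => |iteratedDeriv 0 w (x + y) + iteratedDeriv 0 w (x - y)
      - 2 * w x - iteratedDeriv 2 w x * y ^ 2|) (closure (Ico 0 h)) := by
    rw [hcl, iteratedDeriv_zero]
    have c1 : ContinuousOn (fun y => w (x + y)) (Icc 0 h) :=
      hc.comp (by fun_prop) (fun y hy => ⟨by linarith [hy.1], by linarith [hy.2]⟩)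
    have c2 : ContinuousOn (fun y => w (x - y)) (Icc 0 h) :=
      hc.comp (by fun_prop) (fun y hy => ⟨by linarith [hy.2], by linarith [hy.1]⟩)
    exact (((c1.add c2).sub continuousOn_const).sub (by fun_prop)).abs
  have := le_on_closure h0 hcont continuousOn_const (x := h) (by rw [hcl]; exact ⟨hh.le, le_rfl⟩)
  simp only [iteratedDeriv_zero] at this
  calc _ = |w (x + h) + w (x - h) - 2 * w x - iteratedDeriv 2 w x * h ^ 2| := by ring_nf
    _ ≤ _ := this
    _ = _ := by ring

lemma uniformMesh_mem_Ioo {l : ℝ} (hl : 0 < l) {M i : ℕ} (hi : 1 ≤ i) (hiM : i + 1 ≤ M) :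
    uniformMesh l M i ∈ Ioo 0 l := by
  have hM : (0 : ℝ) < M := by exact_mod_cast (by omega : 0 < M)
  have hi0 : (0 : ℝ) < i := by exact_mod_cast hi
  have h1 : (i : ℝ) < M := by exact_mod_cast hiM
  unfold uniformMesh
  refine ⟨by positivity, ?_⟩
  rw [mul_div_assoc', div_lt_iff₀ hM]
  nlinarith

lemma uniformMesh_mem_Icc {l : ℝ} (hl : 0 < l) {M i : ℕ} (hM1 : 1 ≤ M) (hiM : i ≤ M) :
    uniformMesh l M i ∈ Icc 0 l := by
  have hM : (0 : ℝ) < M := by exact_mod_cast hM1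
  have h1 : (i : ℝ) ≤ M := by exact_mod_cast hiM
  unfold uniformMesh
  refine ⟨by positivity, ?_⟩
  rw [mul_div_assoc', div_le_iff₀ hM]
  nlinarith

lemma abs_iteratedDeriv_two_sub_centralDiff_le {w : ℝ → ℝ} {l K : ℝ} (hl : 0 < l) (hK : 0 ≤ K)
    (hc : ContinuousOn w (Icc 0 l)) (hw : ContDiffOn ℝ 4 w (Ioo 0 l))
    (hb : ∀ y ∈ Ioo 0 l, |iteratedDeriv 4 w y| ≤ K) {M i : ℕ} (hi : 1 ≤ i) (hiM : i + 1 ≤ M) :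
    |iteratedDeriv 2 w (uniformMesh l M i)
      - centralDiff (l / (M : ℝ)) (fun j => w (uniformMesh l M j)) i| ≤ 2 * K * (l / M) ^ 2 := by
  have hM : (0 : ℝ) < M := by exact_mod_cast (by omega : 0 < M)
  have hh : 0 < l / M := by positivity
  have ep : uniformMesh l M (i + 1) = uniformMesh l M i + l / M := by
    unfold uniformMesh; push_cast; ring
  have em : uniformMesh l M (i - 1) = uniformMesh l M i - l / M := by
    unfold uniformMesh; push_cast [hi]; ring
  have key := abs_second_difference_sub_le hK hh hc hw hb (x := uniformMesh l M i)
    (em ▸ (uniformMesh_mem_Icc hl (by omega) (by omega)).1)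
    (ep ▸ (uniformMesh_mem_Icc hl (by omega) hiM).2)
  unfold centralDiff
  dsimp only
  rw [ep, em, abs_sub_comm, ← mul_le_mul_iff_of_pos_right (pow_pos hh 2), ← abs_of_pos (pow_pos hh 2),
    ← abs_mul, abs_of_pos (pow_pos hh 2), sub_mul, div_mul_cancel₀ _ (pow_pos hh 2).ne']
  calc _ = |w (uniformMesh l M i + l / M) + w (uniformMesh l M i - l / M)
        - 2 * w (uniformMesh l M i)
        - (l / M) ^ 2 * iteratedDeriv 2 w (uniformMesh l M i)| := by ring_nf
    _ ≤ _ := key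
    _ = _ := by ring

/-! ### Integrals with weakly singular kernels -/

lemma ae_restrict_uIoc_of_Ioo {a b : ℝ} (hab : a ≤ b) {p : ℝ → Prop} (h : ∀ s ∈ Ioo a b, p s) :
    ∀ᵐ s ∂volume.restrict (uIoc a b), p s := by
  rw [uIoc_of_le hab, ← Measure.restrict_congr_set Ioo_ae_eq_Ioc]
  exact ae_restrict_of_forall_mem measurableSet_Ioo h

lemma abs_intervalIntegral_le_of_Ioo {a b : ℝ} (hab : a ≤ b) {f g : ℝ → ℝ}
    (h : ∀ s ∈ Ioo a b, |f s| ≤ g s) (hg : IntervalIntegrable g volume a b) :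
    |∫ s in a..b, f s| ≤ ∫ s in a..b, g s := by
  rw [intervalIntegral.integral_of_le hab, intervalIntegral.integral_of_le hab, ← Real.norm_eq_abs]
  refine norm_integral_le_of_norm_le hg.1 ?_
  have := ae_restrict_uIoc_of_Ioo hab h
  rwa [uIoc_of_le hab] at this

lemma intervalIntegrable_of_le_Ioo {a b : ℝ} (hab : a ≤ b) {f g : ℝ → ℝ} (hf : Measurable f)
    (h : ∀ s ∈ Ioo a b, |f s| ≤ g s) (hg : IntervalIntegrable g volume a b) :
    IntervalIntegrable f volume a b :=
  hg.mono_fun' hf.aestronglyMeasurable (ae_restrict_uIoc_of_Ioo hab h)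

lemma intervalIntegrable_sub_rpow_neg {α : ℝ} (hα1 : α < 1) (a b c : ℝ) :
    IntervalIntegrable (fun s => (c - s) ^ (-α)) volume a b := by
  have := (intervalIntegral.intervalIntegrable_rpow' (a := c - a) (b := c - b)
    (by linarith : -1 < -α)).comp_sub_left c
  simpa using this

lemma integral_sub_rpow_neg {α : ℝ} (hα1 : α < 1) (a b c : ℝ) :
    ∫ s in a..b, (c - s) ^ (-α) = ((c - a) ^ (1 - α) - (c - b) ^ (1 - α)) / (1 - α) := by
  rw [intervalIntegral.integral_comp_sub_left (fun x => x ^ (-α)) c,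
    integral_rpow (Or.inl (by linarith))]
  ring_nf

/-- The two singularities are separated at `c / 2`: on each half one factor is bounded by its value
at the midpoint. -/
lemma rpow_mul_sub_rpow_le {α s c : ℝ} (hα0 : 0 < α) (hα1 : α < 1) (hs : s ∈ Ioo 0 c) :
    s ^ (α - 1) * (c - s) ^ (-α)
      ≤ (c / 2) ^ (-α) * s ^ (α - 1) + (c / 2) ^ (α - 1) * (c - s) ^ (-α) := by
  have hc : 0 < c := hs.1.trans hs.2
  have h1 : 0 ≤ s ^ (α - 1) := Real.rpow_nonneg hs.1.le _
  have h2 : 0 ≤ (c - s) ^ (-α) := Real.rpow_nonneg (by linarith [hs.2]) _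
  have h3 : 0 ≤ (c / 2) ^ (α - 1) := by positivity
  have h4 : 0 ≤ (c / 2) ^ (-α) := by positivity
  rcases le_total s (c / 2) with h | h
  · have : (c - s) ^ (-α) ≤ (c / 2) ^ (-α) :=
      Real.rpow_le_rpow_of_nonpos (by positivity) (by linarith) (by linarith)
    nlinarith [mul_le_mul_of_nonneg_left this h1, mul_nonneg h3 h2]
  · have : s ^ (α - 1) ≤ (c / 2) ^ (α - 1) :=
      Real.rpow_le_rpow_of_nonpos (by positivity) h (by linarith)
    nlinarith [mul_le_mul_of_nonneg_right this h2, mul_nonneg h4 h1]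

lemma intervalIntegrable_deriv_of_le_rpow {α A b : ℝ} (hα0 : 0 < α) (hb : 0 ≤ b) {v : ℝ → ℝ}
    (hv : ∀ s ∈ Ioo 0 b, |deriv v s| ≤ A * s ^ (α - 1)) :
    IntervalIntegrable (deriv v) volume 0 b :=
  intervalIntegrable_of_le_Ioo hb (measurable_deriv v) hv
    ((intervalIntegral.intervalIntegrable_rpow' (by linarith)).const_mul A)

lemma intervalIntegrable_deriv_mul_kernel {α A c : ℝ} (hα0 : 0 < α) (hα1 : α < 1) (hc : 0 ≤ c)
    (hA : 0 ≤ A) {v : ℝ → ℝ} (hv : ∀ s ∈ Ioo 0 c, |deriv v s| ≤ A * s ^ (α - 1)) :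
    IntervalIntegrable (fun s => deriv v s * (c - s) ^ (-α)) volume 0 c := by
  refine intervalIntegrable_of_le_Ioo hc ((measurable_deriv v).mul (by fun_prop))
    (g := fun s => A * ((c / 2) ^ (-α) * s ^ (α - 1) + (c / 2) ^ (α - 1) * (c - s) ^ (-α))) ?_ ?_
  · intro s hs
    have h2 : 0 ≤ (c - s) ^ (-α) := Real.rpow_nonneg (by linarith [hs.2]) _
    rw [abs_mul, abs_of_nonneg h2]
    calc _ ≤ A * s ^ (α - 1) * (c - s) ^ (-α) := mul_le_mul_of_nonneg_right (hv s hs) h2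
      _ = A * (s ^ (α - 1) * (c - s) ^ (-α)) := by ring
      _ ≤ _ := mul_le_mul_of_nonneg_left (rpow_mul_sub_rpow_le hα0 hα1 hs) hA
  · exact (((intervalIntegral.intervalIntegrable_rpow' (by linarith)).const_mul _).add
      ((intervalIntegrable_sub_rpow_neg hα1 _ _ _).const_mul _)).const_mul A

/-- The quotient `c / (c - s)` decreases in `c`. Hence the weighted first-interval error is worst at
the first time level `c = b`. -/
lemma rpow_mul_sub_rpow_neg_le {α s b c : ℝ} (hα0 : 0 < α) (hs : s ∈ Ioo 0 b) (hbc : b ≤ c) :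
    c ^ α * (c - s) ^ (-α) ≤ b ^ α * (b - s) ^ (-α) := by
  have hb : 0 < b := hs.1.trans hs.2
  have hc : 0 < c := hb.trans_le hbc
  have h1 : 0 < b - s := sub_pos.2 hs.2
  have h2 : 0 < c - s := by linarith
  rw [Real.rpow_neg h1.le, Real.rpow_neg h2.le, ← div_eq_mul_inv, ← div_eq_mul_inv,
    ← Real.div_rpow hc.le h2.le, ← Real.div_rpow hb.le h1.le]
  refine Real.rpow_le_rpow (by positivity) ?_ hα0.le
  rw [div_le_div_iff₀ h2 h1]
  nlinarith [hs.1]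

/-! ### Truncation error on a single mesh interval -/

/-- Contribution of the first mesh interval `[0,b]` to the truncation error at time `c`. -/
lemma abs_integral_first_interval_le {α A b c : ℝ} (hα0 : 0 < α) (hα1 : α < 1) (hA : 0 ≤ A)
    (hb : 0 < b) (hbc : b ≤ c) {v : ℝ → ℝ} (hc : ContinuousOn v (Icc 0 b))
    (hd : DifferentiableOn ℝ v (Ioo 0 b)) (hv : ∀ s ∈ Ioo 0 b, |deriv v s| ≤ A * s ^ (α - 1)) :
    c ^ α * |∫ s in (0 : ℝ)..b, (deriv v s - (v b - v 0) / b) * (c - s) ^ (-α)|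
      ≤ A * (3 / (α * (1 - α))) * b ^ α := by
  have hc0 : 0 < c := hb.trans_le hbc
  have h1α : 0 < 1 - α := by linarith
  have hint := intervalIntegrable_deriv_of_le_rpow hα0 hb.le hv
  have hrp : IntervalIntegrable (fun s : ℝ => s ^ (α - 1)) volume 0 b :=
    intervalIntegral.intervalIntegrable_rpow' (by linarith)
  have hirp : ∫ s in (0 : ℝ)..b, s ^ (α - 1) = b ^ α / α := by
    rw [integral_rpow (Or.inl (by linarith))]
    simp [hα0.ne']
  have hδ : |(v b - v 0) / b| ≤ A * b ^ (α - 1) / α := by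
    have hftc := intervalIntegral.integral_eq_sub_of_hasDerivAt_of_le hb.le hc
      (fun x hx => (hd.differentiableAt (Ioo_mem_nhds hx.1 hx.2)).hasDerivAt) hint
    have h2 := abs_intervalIntegral_le_of_Ioo hb.le hv (hrp.const_mul A)
    rw [hftc, intervalIntegral.integral_const_mul, hirp] at h2
    rw [abs_div, abs_of_pos hb, div_le_iff₀ hb]
    have : b ^ α = b ^ (α - 1) * b := by
      rw [← Real.rpow_add_one hb.ne']; congr 1; ring
    calc _ ≤ A * (b ^ α / α) := h2
      _ = _ := by rw [this]; ring
  set δ := (v b - v 0) / b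
  -- Majorant with `c` replaced by `b`: the bound on `v'` is split at `b / 2`, and the slope
  -- contributes the last term.
  set g : ℝ → ℝ := fun s => b ^ α * (A * ((b / 2) ^ (-α) * s ^ (α - 1)
      + (b / 2) ^ (α - 1) * (b - s) ^ (-α)) + A * b ^ (α - 1) / α * (b - s) ^ (-α)) with hg
  have hker := intervalIntegrable_sub_rpow_neg hα1 0 b b
  have hgint : IntervalIntegrable g volume 0 b :=
    ((((hrp.const_mul _).add (hker.const_mul _)).const_mul A).add (hker.const_mul _)).const_mul _
  have hbd : ∀ s ∈ Ioo 0 b, |c ^ α * ((deriv v s - δ) * (c - s) ^ (-α))| ≤ g s := by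
    intro s hs
    have h2 : 0 ≤ (c - s) ^ (-α) := Real.rpow_nonneg (by linarith [hs.2]) _
    have h3 : 0 ≤ (b - s) ^ (-α) := Real.rpow_nonneg (by linarith [hs.2]) _
    have h4 : |deriv v s - δ| ≤ A * s ^ (α - 1) + A * b ^ (α - 1) / α :=
      (abs_sub _ _).trans (add_le_add (hv s hs) hδ)
    have h5 := rpow_mul_sub_rpow_neg_le hα0 hs hbc
    have h6 := mul_le_mul_of_nonneg_left (rpow_mul_sub_rpow_le hα0 hα1 hs) hA
    have h7 : 0 ≤ b ^ α := by positivity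
    rw [abs_mul, abs_mul, abs_of_nonneg h2, abs_of_nonneg (by positivity)]
    calc c ^ α * (|deriv v s - δ| * (c - s) ^ (-α))
        = |deriv v s - δ| * (c ^ α * (c - s) ^ (-α)) := by ring
      _ ≤ (A * s ^ (α - 1) + A * b ^ (α - 1) / α) * (b ^ α * (b - s) ^ (-α)) :=
          mul_le_mul h4 h5 (by positivity) ((abs_nonneg _).trans h4)
      _ = b ^ α * (A * (s ^ (α - 1) * (b - s) ^ (-α))
          + A * b ^ (α - 1) / α * (b - s) ^ (-α)) := by ring
      _ ≤ g s := mul_le_mul_of_nonneg_left (by linarith) h7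
  have hfin := abs_intervalIntegral_le_of_Ioo hb.le hbd hgint
  rw [intervalIntegral.integral_const_mul, abs_mul, abs_of_nonneg (by positivity)] at hfin
  refine hfin.trans ?_
  have hik : ∫ s in (0 : ℝ)..b, (b - s) ^ (-α) = b ^ (1 - α) / (1 - α) := by
    rw [integral_sub_rpow_neg hα1, sub_self, Real.zero_rpow h1α.ne', sub_zero, sub_zero]
  have hgval : ∫ s in (0 : ℝ)..b, g s = b ^ α * (A * ((b / 2) ^ (-α) * (b ^ α / α)
      + (b / 2) ^ (α - 1) * (b ^ (1 - α) / (1 - α)))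
      + A * b ^ (α - 1) / α * (b ^ (1 - α) / (1 - α))) := by
    rw [hg, intervalIntegral.integral_const_mul, intervalIntegral.integral_add
      (((hrp.const_mul _).add (hker.const_mul _)).const_mul A) (hker.const_mul _),
      intervalIntegral.integral_const_mul, intervalIntegral.integral_add (hrp.const_mul _)
      (hker.const_mul _), intervalIntegral.integral_const_mul, intervalIntegral.integral_const_mul,
      intervalIntegral.integral_const_mul, hirp, hik]
  have e1 : (b / 2) ^ (-α) * b ^ α ≤ 2 := by
    rw [Real.rpow_neg (by positivity), ← Real.inv_rpow (by positivity),
      ← Real.mul_rpow (by positivity) hb.le]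
    have : (b / 2)⁻¹ * b = 2 := by field_simp
    rw [this]
    exact Real.rpow_le_self_of_one_le (by norm_num) hα1.le
  have e2 : (b / 2) ^ (α - 1) * b ^ (1 - α) ≤ 2 := by
    rw [show α - 1 = -(1 - α) by ring, Real.rpow_neg (by positivity),
      ← Real.inv_rpow (by positivity), ← Real.mul_rpow (by positivity) hb.le]
    have : (b / 2)⁻¹ * b = 2 := by field_simp
    rw [this]
    exact Real.rpow_le_self_of_one_le (by norm_num) (by linarith)
  have e3 : b ^ (α - 1) * b ^ (1 - α) = 1 := by
    rw [← Real.rpow_add hb]; simp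
  rw [hgval]
  calc _ = A * b ^ α * ((b / 2) ^ (-α) * b ^ α / α + (b / 2) ^ (α - 1) * b ^ (1 - α) / (1 - α)
        + (b ^ (α - 1) * b ^ (1 - α)) / (α * (1 - α))) := by field_simp
    _ ≤ A * b ^ α * (2 / α + 2 / (1 - α) + 1 / (α * (1 - α))) := by
        rw [e3]
        gcongr
    _ = _ := by field_simp; ring

lemma abs_deriv_sub_slope_le {a b L : ℝ} (hab : a < b) {v : ℝ → ℝ} (hc : ContinuousOn v (Icc a b))
    (hd : DifferentiableOn ℝ v (Ioo a b)) (hdd : DifferentiableOn ℝ (deriv v) (Ioo a b))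
    (hL : ∀ s ∈ Ioo a b, |deriv (deriv v) s| ≤ L) :
    ∀ s ∈ Ioo a b, |deriv v s - (v b - v a) / (b - a)| ≤ L * (b - a) := by
  intro s hs
  obtain ⟨ξ, hξ, h⟩ := exists_deriv_eq_slope v hab hc hd
  rw [← h]
  have := (convex_Ioo a b).norm_image_sub_le_of_norm_deriv_le
    (fun z hz => hdd.differentiableAt (Ioo_mem_nhds hz.1 hz.2)) hL hξ hs
  refine this.trans (mul_le_mul_of_nonneg_left ?_ ((abs_nonneg _).trans (hL s hs)))
  rw [Real.norm_eq_abs, abs_le]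
  exact ⟨by linarith [hξ.2, hs.1], by linarith [hξ.1, hs.2]⟩

/-- Contribution of a mesh interval `[a,b]`, `b < c`, to the truncation error at time `c`. -/
lemma abs_integral_interval_le {α a b c E : ℝ} (hα0 : 0 < α) (hab : a < b) (hbc : b < c)
    {v : ℝ → ℝ} (hc : ContinuousOn v (Icc a b)) (hd : DifferentiableOn ℝ v (Ioo a b))
    (hint : IntervalIntegrable (deriv v) volume a b)
    (hE : ∀ s ∈ Ioo a b, |deriv v s - (v b - v a) / (b - a)| ≤ E) :
    |∫ s in a..b, (deriv v s - (v b - v a) / (b - a)) * (c - s) ^ (-α)|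
      ≤ E * (b - a) * ((c - b) ^ (-α) - (c - a) ^ (-α)) := by
  set δ := (v b - v a) / (b - a) with hδ
  have hi0 : IntervalIntegrable (fun s => deriv v s - δ) volume a b :=
    hint.sub intervalIntegrable_const
  have hz : ∫ s in a..b, (deriv v s - δ) = 0 := by
    rw [intervalIntegral.integral_sub hint intervalIntegrable_const,
      intervalIntegral.integral_eq_sub_of_hasDerivAt_of_le hab.le hc
      (fun x hx => (hd.differentiableAt (Ioo_mem_nhds hx.1 hx.2)).hasDerivAt) hint,
      intervalIntegral.integral_const, smul_eq_mul, hδ, mul_div_cancel₀ _ (sub_pos.2 hab).ne',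
      sub_self]
  have hk : ContinuousOn (fun s => (c - s) ^ (-α)) (uIcc a b) := by
    rw [uIcc_of_le hab.le]
    refine ContinuousOn.rpow_const (by fun_prop) fun s hs => Or.inl ?_
    linarith [hs.2]
  -- Since `deriv v - δ` has mean zero, a constant may be subtracted from the kernel.
  have heq : ∫ s in a..b, (deriv v s - δ) * (c - s) ^ (-α)
      = ∫ s in a..b, (deriv v s - δ) * ((c - s) ^ (-α) - (c - a) ^ (-α)) := by
    simp only [mul_sub _ ((c - _) ^ (-α))]
    rw [intervalIntegral.integral_sub (hi0.mul_continuousOn hk) (hi0.mul_const _),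
      intervalIntegral.integral_mul_const, hz, zero_mul, sub_zero]
  rw [heq]
  have := abs_intervalIntegral_le_of_Ioo hab.le
    (f := fun s => (deriv v s - δ) * ((c - s) ^ (-α) - (c - a) ^ (-α)))
    (g := fun _ => E * ((c - b) ^ (-α) - (c - a) ^ (-α))) (fun s hs => by
      have h1 : (c - a) ^ (-α) ≤ (c - s) ^ (-α) := Real.rpow_le_rpow_of_nonpos
        (by linarith [hs.2]) (by linarith [hs.1]) (by linarith)
      have h2 : (c - s) ^ (-α) ≤ (c - b) ^ (-α) := Real.rpow_le_rpow_of_nonpos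
        (by linarith [hs.2]) (by linarith [hs.2]) (by linarith)
      rw [abs_mul, abs_of_nonneg (sub_nonneg.2 h1)]
      exact mul_le_mul (hE s hs) (by linarith) (by linarith) ((abs_nonneg _).trans (hE s hs)))
    intervalIntegrable_const
  refine this.trans_eq ?_
  rw [intervalIntegral.integral_const, smul_eq_mul]
  ring

/-- Contribution of the last mesh interval `[a,c]` to the truncation error at time `c`. -/
lemma abs_integral_last_interval_le {α a c E δ : ℝ} (hα1 : α < 1) (hac : a < c) {v : ℝ → ℝ}
    (hE : ∀ s ∈ Ioo a c, |deriv v s - δ| ≤ E) :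
    |∫ s in a..c, (deriv v s - δ) * (c - s) ^ (-α)|
      ≤ E * (c - a) * ((c - a) ^ (-α) / (1 - α)) := by
  have hpos : 0 < c - a := sub_pos.2 hac
  have := abs_intervalIntegral_le_of_Ioo hac.le
    (f := fun s => (deriv v s - δ) * (c - s) ^ (-α)) (g := fun s => E * (c - s) ^ (-α))
    (fun s hs => by
      have h2 : 0 ≤ (c - s) ^ (-α) := Real.rpow_nonneg (by linarith [hs.2]) _
      rw [abs_mul, abs_of_nonneg h2]
      exact mul_le_mul_of_nonneg_right (hE s hs) h2)
    ((intervalIntegrable_sub_rpow_neg hα1 _ _ _).const_mul E)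
  refine this.trans_eq ?_
  rw [intervalIntegral.integral_const_mul, integral_sub_rpow_neg hα1, sub_self,
    Real.zero_rpow (by linarith), sub_zero, sub_eq_add_neg 1 α, add_comm 1 (-α),
    Real.rpow_add_one hpos.ne']
  ring

/-! ### Estimates on the graded mesh -/

lemma gradedMesh_zero {T r : ℝ} (hr : 1 ≤ r) (N : ℕ) : gradedMesh T r N 0 = 0 := by
  simp [gradedMesh, Real.zero_rpow (by linarith : r ≠ 0)]

lemma gradedMesh_self {T r : ℝ} {N : ℕ} (hN : 1 ≤ N) : gradedMesh T r N N = T := by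
  have : (N : ℝ) ≠ 0 := by exact_mod_cast (by omega : N ≠ 0)
  simp [gradedMesh, div_self this]

lemma strictMono_gradedMesh {T r : ℝ} (hT : 0 < T) (hr : 1 ≤ r) {N : ℕ} (hN : 1 ≤ N) :
    StrictMono (gradedMesh T r N) := by
  intro a b hab
  have hN0 : (0 : ℝ) < N := by exact_mod_cast hN
  have : (a : ℝ) < b := by exact_mod_cast hab
  exact mul_lt_mul_of_pos_left
    (Real.rpow_lt_rpow (by positivity) (by gcongr) (by linarith)) hT

lemma gradedMesh_eq_mul_rpow {T r : ℝ} {N k n : ℕ} (hn : 1 ≤ n) :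
    gradedMesh T r N k = gradedMesh T r N n * ((k : ℝ) / n) ^ r := by
  have hn0 : (n : ℝ) ≠ 0 := by exact_mod_cast (by omega : n ≠ 0)
  unfold gradedMesh
  rw [mul_assoc, ← Real.mul_rpow (by positivity) (by positivity)]
  congr 2
  field_simp

/-- For `r ≥ 1`, `t k / t n = (k / n) ^ r ≤ k / n`, so the graded mesh is no worse here than the
uniform one. -/
lemma gradedMesh_rpow_mul_sub_rpow_neg_le {α T r : ℝ} (hα0 : 0 < α) (hT : 0 < T) (hr : 1 ≤ r)
    {N k n : ℕ} (hN : 1 ≤ N) (hkn : k < n) :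
    gradedMesh T r N n ^ α * (gradedMesh T r N n - gradedMesh T r N k) ^ (-α)
      ≤ ((n : ℝ) / (n - k)) ^ α := by
  have hmono := strictMono_gradedMesh hT hr hN
  have hn0 : (0 : ℝ) < n := by exact_mod_cast (by omega : 0 < n)
  have hk0 : (k : ℝ) < n := by exact_mod_cast hkn
  have htn : 0 < gradedMesh T r N n := gradedMesh_zero hr N (T := T) ▸ hmono (by omega : 0 < n)
  have hd : 0 < gradedMesh T r N n - gradedMesh T r N k := sub_pos.2 (hmono hkn)
  rw [Real.rpow_neg hd.le, ← div_eq_mul_inv, ← Real.div_rpow htn.le hd.le]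
  refine Real.rpow_le_rpow (by positivity) ?_ hα0.le
  have hq : ((k : ℝ) / n) ^ r ≤ (k : ℝ) / n :=
    Real.rpow_le_self_of_le_one (by positivity) ((div_le_one hn0).2 hk0.le) hr
  have h1 : gradedMesh T r N k ≤ gradedMesh T r N n * ((k : ℝ) / n) := by
    rw [gradedMesh_eq_mul_rpow (k := k) (n := n) (by omega)]
    exact mul_le_mul_of_nonneg_left hq htn.le
  rw [div_le_div_iff₀ hd (sub_pos.2 hk0)]
  have h2 : gradedMesh T r N n * ((k : ℝ) / n) * n = gradedMesh T r N n * k := by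
    field_simp
  nlinarith

/-- Bernoulli bounds the step by `r * t (k + 1) / (k + 1)`; then `(k + 1) / k ≤ 2` gives `t (k + 1)
≤ 2 ^ r * t k`. -/
lemma gradedMesh_succ_sub_le {T r : ℝ} (hT : 0 < T) (hr : 1 ≤ r) {N k : ℕ} (hN : 1 ≤ N)
    (hk : 1 ≤ k) :
    gradedMesh T r N (k + 1) - gradedMesh T r N k ≤ r * 2 ^ r * (gradedMesh T r N k / k) := by
  have hmono := strictMono_gradedMesh hT hr hN
  have hk0 : (0 : ℝ) < k := by exact_mod_cast hk
  have hk1 : (1 : ℝ) ≤ k := by exact_mod_cast hk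
  have htk : 0 < gradedMesh T r N k := gradedMesh_zero hr N (T := T) ▸ hmono hk
  have hB := one_add_mul_self_le_rpow_one_add (s := -(1 / ((k : ℝ) + 1))) (p := r)
    (by rw [neg_le_neg_iff, div_le_one (by positivity)]; linarith) hr
  have e1 : 1 + -(1 / ((k : ℝ) + 1)) = (k : ℝ) / (k + 1 : ℕ) := by
    push_cast; field_simp; ring
  rw [e1] at hB
  have h1 : gradedMesh T r N (k + 1) ≤ 2 ^ r * gradedMesh T r N k := by
    rw [gradedMesh_eq_mul_rpow (k := k + 1) (n := k) hk, mul_comm]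
    refine mul_le_mul_of_nonneg_right (Real.rpow_le_rpow (by positivity) ?_ (by linarith)) htk.le
    rw [div_le_iff₀ hk0]
    push_cast
    linarith
  have htk1 : 0 < gradedMesh T r N (k + 1) := htk.trans (hmono (Nat.lt_succ_self k))
  have h2 := mul_le_mul_of_nonneg_left hB htk1.le
  rw [← gradedMesh_eq_mul_rpow (by omega)] at h2
  calc gradedMesh T r N (k + 1) - gradedMesh T r N k
      ≤ r * (gradedMesh T r N (k + 1) * (1 / ((k : ℝ) + 1))) := by linarith
    _ ≤ r * ((2 ^ r * gradedMesh T r N k) * (1 / (k : ℝ))) := by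
        gcongr
        linarith
    _ = _ := by ring

lemma gradedMesh_rpow_le {α β T r : ℝ} (hT : 0 < T) (hβ : β ≤ r * α) {N k : ℕ} (hk : 1 ≤ k)
    (hkN : k ≤ N) :
    gradedMesh T r N k ^ α ≤ T ^ α * (N : ℝ) ^ (-β) * (k : ℝ) ^ β := by
  have hk0 : (0 : ℝ) < k := by exact_mod_cast hk
  have hN0 : (0 : ℝ) < N := by exact_mod_cast (by omega : 0 < N)
  have hkN' : (k : ℝ) ≤ N := by exact_mod_cast hkN
  unfold gradedMesh
  rw [Real.mul_rpow hT.le (by positivity), ← Real.rpow_mul (by positivity), mul_assoc]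
  refine mul_le_mul_of_nonneg_left ?_ (by positivity)
  calc ((k : ℝ) / N) ^ (r * α) ≤ ((k : ℝ) / N) ^ β :=
        Real.rpow_le_rpow_of_exponent_ge (by positivity) ((div_le_one hN0).2 hkN') hβ
    _ = _ := by
      rw [Real.div_rpow hk0.le hN0.le, Real.rpow_neg hN0.le]
      ring

/-- With step at most a multiple of `t k / k`, the left side is of order `t k ^ α / k ^ 2`, hence `N
^ (-β) * k ^ (β - 2)`. Both constraints on `β` enter: `β ≤ r * α` in bounding `t k ^ α`, and `β ≤ 2
- α` in `k ^ (β - 2) ≤ k ^ (-α)`. -/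
lemma step_sq_mul_gradedMesh_rpow_le {α β T r : ℝ} (hT : 0 < T) (hr : 1 ≤ r)
    (hβ : β ≤ r * α) (hβ2 : β ≤ 2 - α) {N k : ℕ} (hk : 1 ≤ k) (hkN : k ≤ N) :
    (gradedMesh T r N (k + 1) - gradedMesh T r N k) ^ 2 * gradedMesh T r N k ^ (α - 2)
      ≤ (r * 2 ^ r) ^ 2 * (T ^ α * (N : ℝ) ^ (-β)) * (k : ℝ) ^ (-α) := by
  have hN : 1 ≤ N := hk.trans hkN
  have hmono := strictMono_gradedMesh hT hr hN
  have hk0 : (0 : ℝ) < k := by exact_mod_cast hk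
  have hN0 : (0 : ℝ) < N := by exact_mod_cast hN
  have htk : 0 < gradedMesh T r N k := gradedMesh_zero hr N (T := T) ▸ hmono hk
  have hstep : 0 ≤ gradedMesh T r N (k + 1) - gradedMesh T r N k :=
    (sub_pos.2 (hmono (Nat.lt_succ_self k))).le
  have e1 : gradedMesh T r N k ^ (α - 2) * gradedMesh T r N k ^ 2 = gradedMesh T r N k ^ α := by
    rw [← Real.rpow_natCast, ← Real.rpow_add htk]
    norm_num
  have e2 : (k : ℝ) ^ β / (k : ℝ) ^ 2 ≤ (k : ℝ) ^ (-α) := by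
    rw [← Real.rpow_natCast, ← Real.rpow_sub hk0]
    refine Real.rpow_le_rpow_of_exponent_le (by exact_mod_cast hk) ?_
    push_cast
    linarith
  calc (gradedMesh T r N (k + 1) - gradedMesh T r N k) ^ 2 * gradedMesh T r N k ^ (α - 2)
      ≤ (r * 2 ^ r * (gradedMesh T r N k / k)) ^ 2 * gradedMesh T r N k ^ (α - 2) := by
        gcongr
        exact gradedMesh_succ_sub_le hT hr hN hk
    _ = (r * 2 ^ r) ^ 2 * (gradedMesh T r N k ^ (α - 2) * gradedMesh T r N k ^ 2) / (k : ℝ) ^ 2 := by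
        ring
    _ ≤ (r * 2 ^ r) ^ 2 * (T ^ α * (N : ℝ) ^ (-β) * (k : ℝ) ^ β) / (k : ℝ) ^ 2 := by
        rw [e1]
        gcongr
        exact gradedMesh_rpow_le hT hβ hk hkN
    _ = (r * 2 ^ r) ^ 2 * (T ^ α * (N : ℝ) ^ (-β)) * ((k : ℝ) ^ β / (k : ℝ) ^ 2) := by ring
    _ ≤ _ := by gcongr

/-! ### Summation over the mesh -/

/-- Abel-type estimate for a monotone sequence `b`, splitting the sum in the middle. -/
lemma sum_rpow_neg_mul_sub_le {α : ℝ} (hα0 : 0 < α) (hα1 : α < 1) {b : ℕ → ℝ} {S : ℝ} {n : ℕ}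
    (hn : 2 ≤ n) (hb0 : 0 ≤ b 1) (hS : 0 ≤ S)
    (hmono : ∀ k, k + 1 < n → b k ≤ b (k + 1))
    (hb : ∀ k < n, S * b k ≤ ((n : ℝ) / (n - k)) ^ α) :
    S * ∑ k ∈ Finset.Ico 1 (n - 1), (k : ℝ) ^ (-α) * (b (k + 1) - b k) ≤ 5 := by
  -- Below `m` the factor `k ^ (-α)` is bounded by `1` and `S * b m` by `3`; above `m` it is at most
  -- `m ^ (-α)`, which compensates `S * b (n - 1) ≤ n ^ α` up to `2`.
  set m := (n + 1) / 2 with hm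
  have h1m : 1 ≤ m := by omega
  have hmn : m ≤ n - 1 := by omega
  have hm0 : (0 : ℝ) < m := by exact_mod_cast h1m
  have hnneg : ∀ k, 1 ≤ k → k < n → 0 ≤ b k := by
    intro k hk
    induction k, hk using Nat.le_induction with
    | base => exact fun _ => hb0
    | succ k hk ih => exact fun h => (ih (by omega)).trans (hmono k h)
  rw [← Finset.sum_Ico_consecutive _ h1m hmn]
  have s1 : ∑ k ∈ Finset.Ico 1 m, (k : ℝ) ^ (-α) * (b (k + 1) - b k) ≤ b m := by
    calc _ ≤ ∑ k ∈ Finset.Ico 1 m, (b (k + 1) - b k) := by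
          refine Finset.sum_le_sum fun k hk => ?_
          rw [Finset.mem_Ico] at hk
          refine mul_le_of_le_one_left (sub_nonneg.2 (hmono k (by omega))) ?_
          exact Real.rpow_le_one_of_one_le_of_nonpos (by exact_mod_cast hk.1) (by linarith)
      _ = b m - b 1 := Finset.sum_Ico_sub b h1m
      _ ≤ b m := by linarith
  have s2 : ∑ k ∈ Finset.Ico m (n - 1), (k : ℝ) ^ (-α) * (b (k + 1) - b k)
      ≤ (m : ℝ) ^ (-α) * b (n - 1) := by
    calc _ ≤ ∑ k ∈ Finset.Ico m (n - 1), (m : ℝ) ^ (-α) * (b (k + 1) - b k) := by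
          refine Finset.sum_le_sum fun k hk => ?_
          rw [Finset.mem_Ico] at hk
          refine mul_le_mul_of_nonneg_right ?_ (sub_nonneg.2 (hmono k (by omega)))
          exact Real.rpow_le_rpow_of_nonpos hm0 (by exact_mod_cast hk.1) (by linarith)
      _ = (m : ℝ) ^ (-α) * (b (n - 1) - b m) := by
          rw [← Finset.mul_sum, Finset.sum_Ico_sub b hmn]
      _ ≤ _ := by
          refine mul_le_mul_of_nonneg_left ?_ (by positivity)
          linarith [hnneg m h1m (by omega)]
  have c1 : S * b m ≤ 3 := by
    refine (hb m (by omega)).trans ?_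
    have hd : (0 : ℝ) < n - m := by
      have : (m : ℝ) < n := by exact_mod_cast (by omega : m < n)
      linarith
    have : (n : ℝ) / (n - m) ≤ 3 := by
      rw [div_le_iff₀ hd]
      have : (3 * m : ℝ) ≤ 2 * n := by exact_mod_cast (by omega : 3 * m ≤ 2 * n)
      linarith
    calc ((n : ℝ) / (n - m)) ^ α ≤ 3 ^ α := Real.rpow_le_rpow (by positivity) this hα0.le
      _ ≤ 3 := Real.rpow_le_self_of_one_le (by norm_num) hα1.le
  have c2 : S * ((m : ℝ) ^ (-α) * b (n - 1)) ≤ 2 := by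
    have h := hb (n - 1) (by omega)
    have e : (n : ℝ) - ((n - 1 : ℕ) : ℝ) = 1 := by
      rw [Nat.cast_sub (by omega)]; simp
    rw [e, div_one] at h
    calc S * ((m : ℝ) ^ (-α) * b (n - 1)) = (m : ℝ) ^ (-α) * (S * b (n - 1)) := by ring
      _ ≤ (m : ℝ) ^ (-α) * (n : ℝ) ^ α := by gcongr
      _ = ((n : ℝ) / m) ^ α := by
          rw [Real.div_rpow (by positivity) hm0.le, Real.rpow_neg hm0.le]; ring
      _ ≤ 2 ^ α := by
          refine Real.rpow_le_rpow (by positivity) ?_ hα0.le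
          rw [div_le_iff₀ hm0]
          exact_mod_cast (by omega : n ≤ 2 * m)
      _ ≤ 2 := Real.rpow_le_self_of_one_le (by norm_num) hα1.le
  calc _ ≤ S * (b m + (m : ℝ) ^ (-α) * b (n - 1)) :=
        mul_le_mul_of_nonneg_left (add_le_add s1 s2) hS
    _ ≤ 5 := by linarith

/-- Sum over all mesh intervals of the contributions to the truncation error of the L1 formula on
the graded mesh, for a function with a weak singularity at the origin. -/
lemma sum_abs_integral_mesh_le {α β A T r : ℝ} (hα0 : 0 < α) (hα1 : α < 1) (hA : 0 ≤ A)
    (hT : 0 < T) (hr : 1 ≤ r) (hβ : β ≤ r * α) (hβ2 : β ≤ 2 - α) {v : ℝ → ℝ}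
    (hc : ContinuousOn v (Icc 0 T)) (hd : DifferentiableOn ℝ v (Ioo 0 T))
    (hdd : DifferentiableOn ℝ (deriv v) (Ioo 0 T))
    (hv1 : ∀ s ∈ Ioo 0 T, |deriv v s| ≤ A * s ^ (α - 1))
    (hv2 : ∀ s ∈ Ioo 0 T, |deriv (deriv v) s| ≤ A * s ^ (α - 2))
    {N n : ℕ} (hn : 1 ≤ n) (hnN : n ≤ N) {t : ℕ → ℝ} (ht : t = gradedMesh T r N) :
    t n ^ α * ∑ k ∈ Finset.range n, |∫ s in t k..t (k + 1),
        (deriv v s - (v (t (k + 1)) - v (t k)) / (t (k + 1) - t k)) * (t n - s) ^ (-α)|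
      ≤ A * (3 / (α * (1 - α)) + (r * 2 ^ r) ^ 2 * (5 + 2 / (1 - α)))
        * (T ^ α * (N : ℝ) ^ (-β)) := by
  have hN : 1 ≤ N := hn.trans hnN
  have hα' : 0 < 1 - α := by linarith
  have hmono : StrictMono t := ht ▸ strictMono_gradedMesh hT hr hN
  have ht0 : t 0 = 0 := ht ▸ gradedMesh_zero hr N
  have htT : ∀ k ≤ N, t k ≤ T := fun k hk =>
    (hmono.monotone hk).trans_eq (by rw [ht, gradedMesh_self hN])
  have htnn : ∀ k, 0 ≤ t k := fun k => ht0 ▸ hmono.monotone (Nat.zero_le k)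
  have hη : 0 ≤ T ^ α * (N : ℝ) ^ (-β) := by positivity
  set η := T ^ α * (N : ℝ) ^ (-β) with hηdef
  have hIcc : ∀ k, k + 1 ≤ N → Icc (t k) (t (k + 1)) ⊆ Icc 0 T := fun k hk =>
    Icc_subset_Icc (htnn k) (htT _ hk)
  have hIoo : ∀ k, k + 1 ≤ N → Ioo (t k) (t (k + 1)) ⊆ Ioo 0 T := fun k hk =>
    Ioo_subset_Ioo (htnn k) (htT _ hk)
  set F : ℕ → ℝ := fun k => |∫ s in t k..t (k + 1),
    (deriv v s - (v (t (k + 1)) - v (t k)) / (t (k + 1) - t k)) * (t n - s) ^ (-α)| with hF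
  have hfirst : t n ^ α * F 0 ≤ A * (3 / (α * (1 - α))) * η := by
    have h := abs_integral_first_interval_le (c := t n) hα0 hα1 hA (b := t 1) (v := v)
      (ht0 ▸ hmono one_pos) (hmono.monotone hn)
      (hc.mono (by simpa [ht0] using hIcc 0 hN)) (hd.mono (by simpa [ht0] using hIoo 0 hN))
      (fun s hs => hv1 s (by have := hIoo 0 hN; simp only [ht0] at this; exact this hs))
    have h1 : t 1 ^ α ≤ η := by
      have := gradedMesh_rpow_le (T := T) (r := r) (α := α) (β := β) hT hβ le_rfl hN
      simpa [ht, hηdef] using this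
    simp only [hF, zero_add, ht0, sub_zero]
    exact h.trans (mul_le_mul_of_nonneg_left h1 (by positivity))
  have hsq : ∀ k, 1 ≤ k → k + 1 ≤ N → A * t k ^ (α - 2) * (t (k + 1) - t k) * (t (k + 1) - t k)
      ≤ A * ((r * 2 ^ r) ^ 2 * η) * (k : ℝ) ^ (-α) := by
    intro k hk hkN
    have := step_sq_mul_gradedMesh_rpow_le hT hr hβ hβ2 hk (by omega : k ≤ N)
    rw [← ht] at this
    have := mul_le_mul_of_nonneg_left this hA
    calc _ = A * ((t (k + 1) - t k) ^ 2 * t k ^ (α - 2)) := by ring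
      _ ≤ _ := this
      _ = _ := by ring
  have hE : ∀ k, 1 ≤ k → k + 1 ≤ N → ∀ s ∈ Ioo (t k) (t (k + 1)),
      |deriv v s - (v (t (k + 1)) - v (t k)) / (t (k + 1) - t k)|
        ≤ A * t k ^ (α - 2) * (t (k + 1) - t k) := by
    intro k hk hkN
    refine abs_deriv_sub_slope_le (hmono (Nat.lt_succ_self k)) (hc.mono (hIcc k hkN))
      (hd.mono (hIoo k hkN)) (hdd.mono (hIoo k hkN)) fun s hs => ?_
    refine (hv2 s (hIoo k hkN hs)).trans (mul_le_mul_of_nonneg_left ?_ hA)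
    exact Real.rpow_le_rpow_of_nonpos (ht0 ▸ hmono hk) hs.1.le (by linarith)
  have hmid : ∀ k, 1 ≤ k → k + 1 < n → F k ≤ A * ((r * 2 ^ r) ^ 2 * η) *
      ((k : ℝ) ^ (-α) * ((t n - t (k + 1)) ^ (-α) - (t n - t k) ^ (-α))) := by
    intro k hk hkn
    have hlt := hmono (Nat.lt_succ_self k)
    have hltn := hmono hkn
    have hint : IntervalIntegrable (deriv v) volume (t k) (t (k + 1)) := by
      refine (intervalIntegrable_deriv_of_le_rpow hα0 hT.le hv1).mono_set ?_
      rw [uIcc_of_le hlt.le, uIcc_of_le hT.le]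
      exact hIcc k (by omega)
    refine (abs_integral_interval_le hα0 hlt hltn (hc.mono (hIcc k (by omega)))
      (hd.mono (hIoo k (by omega))) hint (hE k hk (by omega))).trans ?_
    rw [← mul_assoc]
    refine mul_le_mul_of_nonneg_right (hsq k hk (by omega)) (sub_nonneg.2 ?_)
    exact Real.rpow_le_rpow_of_nonpos (by linarith) (by linarith) (by linarith)
  have hbn : ∀ k < n, t n ^ α * (t n - t k) ^ (-α) ≤ ((n : ℝ) / (n - k)) ^ α := fun k hk => by
    rw [ht]; exact gradedMesh_rpow_mul_sub_rpow_neg_le hα0 hT hr hN hk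
  have htn0 : 0 ≤ t n ^ α := Real.rpow_nonneg (htnn n) α
  rw [Finset.range_eq_Ico, Finset.sum_eq_sum_Ico_succ_bot (by omega : 0 < n), zero_add]
  rcases hn.eq_or_lt with rfl | hn2
  · rw [Finset.Ico_self, Finset.sum_empty, add_zero]
    refine hfirst.trans (mul_le_mul_of_nonneg_right (mul_le_mul_of_nonneg_left ?_ hA) hη)
    have : 0 ≤ (r * 2 ^ r) ^ 2 * (5 + 2 / (1 - α)) := by positivity
    linarith
  -- Here the kernel is unbounded at `s = t n`, so it is integrated directly instead of using the
  -- mean-zero cancellation.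
  have hlast : t n ^ α * F (n - 1) ≤ A * ((r * 2 ^ r) ^ 2 * η) * (2 / (1 - α)) := by
    obtain ⟨m, rfl⟩ : ∃ m, n = m + 1 := ⟨n - 1, by omega⟩
    have hm1 : 1 ≤ m := by omega
    have hm0 : (0 : ℝ) < m := by exact_mod_cast hm1
    simp only [hF, Nat.add_sub_cancel]
    have h1 := abs_integral_last_interval_le hα1 (hmono (Nat.lt_succ_self m)) (hE m hm1 hnN)
    have hp : 0 ≤ (t (m + 1) - t m) ^ (-α) :=
      Real.rpow_nonneg (sub_pos.2 (hmono (Nat.lt_succ_self m))).le _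
    have h2 := h1.trans (mul_le_mul_of_nonneg_right (hsq m hm1 hnN) (div_nonneg hp hα'.le))
    have h3 : (m : ℝ) ^ (-α) * (t (m + 1) ^ α * (t (m + 1) - t m) ^ (-α)) ≤ 2 := by
      have h := hbn m (Nat.lt_succ_self m)
      have e : ((m + 1 : ℕ) : ℝ) - m = 1 := by push_cast; ring
      rw [e, div_one] at h
      calc _ ≤ (m : ℝ) ^ (-α) * ((m + 1 : ℕ) : ℝ) ^ α := by gcongr
        _ = (((m + 1 : ℕ) : ℝ) / m) ^ α := by
            rw [Real.div_rpow (by positivity) hm0.le, Real.rpow_neg hm0.le]; ring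
        _ ≤ 2 ^ α := by
            refine Real.rpow_le_rpow (by positivity) ?_ hα0.le
            rw [div_le_iff₀ hm0]
            exact_mod_cast (by omega : m + 1 ≤ 2 * m)
        _ ≤ 2 := Real.rpow_le_self_of_one_le (by norm_num) hα1.le
    calc _ ≤ t (m + 1) ^ α * (A * ((r * 2 ^ r) ^ 2 * η) * (m : ℝ) ^ (-α)
          * ((t (m + 1) - t m) ^ (-α) / (1 - α))) := mul_le_mul_of_nonneg_left h2 htn0
      _ = A * ((r * 2 ^ r) ^ 2 * η) * (((m : ℝ) ^ (-α)
          * (t (m + 1) ^ α * (t (m + 1) - t m) ^ (-α))) / (1 - α)) := by ring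
      _ ≤ _ := by gcongr
  have hsum : t n ^ α * ∑ k ∈ Finset.Ico 1 (n - 1), F k ≤ A * ((r * 2 ^ r) ^ 2 * η) * 5 := by
    have h1 := Finset.sum_le_sum (s := Finset.Ico 1 (n - 1)) fun k hk =>
      hmid k (Finset.mem_Ico.1 hk).1 (by have := (Finset.mem_Ico.1 hk).2; omega)
    rw [← Finset.mul_sum] at h1
    have h2 := sum_rpow_neg_mul_sub_le hα0 hα1 (b := fun k => (t n - t k) ^ (-α)) hn2
      (Real.rpow_nonneg (sub_nonneg.2 (hmono.monotone hn)) _) htn0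
      (fun k hk => Real.rpow_le_rpow_of_nonpos (sub_pos.2 (hmono hk))
        (by linarith [hmono (Nat.lt_succ_self k)]) (by linarith)) hbn
    calc _ ≤ t n ^ α * _ := mul_le_mul_of_nonneg_left h1 htn0
      _ = A * ((r * 2 ^ r) ^ 2 * η) * (t n ^ α * ∑ k ∈ Finset.Ico 1 (n - 1),
          ((k : ℝ) ^ (-α) * ((t n - t (k + 1)) ^ (-α) - (t n - t k) ^ (-α)))) := by ring
      _ ≤ _ := mul_le_mul_of_nonneg_left h2 (by positivity)
  have hsplit : ∑ k ∈ Finset.Ico 1 n, F k = ∑ k ∈ Finset.Ico 1 (n - 1), F k + F (n - 1) := by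
    conv_lhs => rw [show n = n - 1 + 1 by omega]
    exact Finset.sum_Ico_succ_top (by omega) F
  rw [hsplit]
  calc _ = t n ^ α * F 0 + t n ^ α * ∑ k ∈ Finset.Ico 1 (n - 1), F k + t n ^ α * F (n - 1) := by
        ring
    _ ≤ A * (3 / (α * (1 - α))) * η + A * ((r * 2 ^ r) ^ 2 * η) * 5
        + A * ((r * 2 ^ r) ^ 2 * η) * (2 / (1 - α)) := by linarith
    _ = _ := by ring

/-! ### Truncation error of the L1 formula -/

lemma temperedL1_eq_sum_integral {α ρ : ℝ} (hα1 : α < 1) (t v : ℕ → ℝ) (n : ℕ) :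
    temperedL1 α ρ t v n = Real.exp (-ρ * t n) / Real.Gamma (1 - α) * ∑ k ∈ Finset.range n,
      (Real.exp (ρ * t (k + 1)) * v (k + 1) - Real.exp (ρ * t k) * v k) / (t (k + 1) - t k)
        * ∫ s in t k..t (k + 1), (t n - s) ^ (-α) := by
  have h1 : 1 - α ≠ 0 := by linarith
  have hΓ : Real.Gamma (1 - α) ≠ 0 := (Real.Gamma_pos_of_pos (by linarith)).ne'
  unfold temperedL1
  rw [Gamma_two_sub hα1, Finset.mul_sum, Finset.mul_sum]
  refine Finset.sum_congr rfl fun k _ => ?_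
  rw [integral_sub_rpow_neg hα1]
  have e : ∀ a, Real.exp (-ρ * (t n - a)) = Real.exp (-ρ * t n) * Real.exp (ρ * a) := fun a => by
    rw [← Real.exp_add]; ring_nf
  rw [e, e]
  field_simp

/-- Truncation error of the L1 formula on the graded mesh. -/
lemma abs_temperedL1_sub_caputoTempered_le {α β ρ A T r : ℝ} (hα0 : 0 < α) (hα1 : α < 1)
    (hρ : 0 ≤ ρ) (hA : 0 ≤ A) (hT : 0 < T) (hr : 1 ≤ r) (hβ : β ≤ r * α) (hβ2 : β ≤ 2 - α)
    {w v : ℝ → ℝ} (hvw : v = fun s => Real.exp (ρ * s) * w s)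
    (hc : ContinuousOn v (Icc 0 T)) (hd : DifferentiableOn ℝ v (Ioo 0 T))
    (hdd : DifferentiableOn ℝ (deriv v) (Ioo 0 T))
    (hv1 : ∀ s ∈ Ioo 0 T, |deriv v s| ≤ A * s ^ (α - 1))
    (hv2 : ∀ s ∈ Ioo 0 T, |deriv (deriv v) s| ≤ A * s ^ (α - 2))
    {N n : ℕ} (hn : 1 ≤ n) (hnN : n ≤ N) :
    Real.Gamma (1 - α) * (gradedMesh T r N n ^ α *
      |temperedL1 α ρ (gradedMesh T r N) (fun k => w (gradedMesh T r N k)) n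
        - caputoTempered α ρ w (gradedMesh T r N n)|)
      ≤ A * (3 / (α * (1 - α)) + (r * 2 ^ r) ^ 2 * (5 + 2 / (1 - α)))
        * (T ^ α * (N : ℝ) ^ (-β)) := by
  have hN : 1 ≤ N := hn.trans hnN
  have key := sum_abs_integral_mesh_le hα0 hα1 hA hT hr hβ hβ2 hc hd hdd hv1 hv2 hn hnN rfl
  set t := gradedMesh T r N with ht
  have hmono : StrictMono t := strictMono_gradedMesh hT hr hN
  have ht0 : t 0 = 0 := gradedMesh_zero hr N
  have htnT : t n ≤ T := (hmono.monotone hnN).trans_eq (gradedMesh_self hN)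
  have htn : 0 < t n := ht0 ▸ hmono hn
  have hΓ : 0 < Real.Gamma (1 - α) := Real.Gamma_pos_of_pos (by linarith)
  have hint : IntervalIntegrable (fun s => deriv v s * (t n - s) ^ (-α)) volume 0 (t n) :=
    intervalIntegrable_deriv_mul_kernel hα0 hα1 htn.le hA
      fun s hs => hv1 s ⟨hs.1, hs.2.trans_le htnT⟩
  have hintk : ∀ k < n, IntervalIntegrable (fun s => deriv v s * (t n - s) ^ (-α)) volume
      (t k) (t (k + 1)) := fun k hk => by
    refine hint.mono_set ?_
    rw [uIcc_of_le (hmono (Nat.lt_succ_self k)).le, uIcc_of_le htn.le]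
    exact Icc_subset_Icc (ht0 ▸ hmono.monotone (Nat.zero_le k)) (hmono.monotone hk)
  have hcap : caputoTempered α ρ w (t n) = Real.exp (-ρ * t n) / Real.Gamma (1 - α) *
      ∑ k ∈ Finset.range n, ∫ s in t k..t (k + 1), deriv v s * (t n - s) ^ (-α) := by
    rw [intervalIntegral.sum_integral_adjacent_intervals hintk, ht0, caputoTempered, ← hvw]
    congr 1
    refine intervalIntegral.integral_congr fun s hs => ?_
    rw [uIcc_of_le htn.le] at hs
    rw [Real.rpow_neg (sub_nonneg.2 hs.2), one_div]
  have hdiff : caputoTempered α ρ w (t n) - temperedL1 α ρ t (fun k => w (t k)) n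
      = Real.exp (-ρ * t n) / Real.Gamma (1 - α) * ∑ k ∈ Finset.range n, ∫ s in t k..t (k + 1),
        (deriv v s - (v (t (k + 1)) - v (t k)) / (t (k + 1) - t k)) * (t n - s) ^ (-α) := by
    rw [hcap, temperedL1_eq_sum_integral hα1, ← mul_sub, ← Finset.sum_sub_distrib]
    congr 1
    refine Finset.sum_congr rfl fun k hk => ?_
    simp only [sub_mul (deriv v _)]
    rw [intervalIntegral.integral_sub (hintk k (Finset.mem_range.1 hk))
      ((intervalIntegrable_sub_rpow_neg hα1 _ _ _).const_mul _),
      intervalIntegral.integral_const_mul, hvw]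
  rw [abs_sub_comm, hdiff, abs_mul, abs_of_pos (div_pos (Real.exp_pos _) hΓ)]
  have hexp : Real.exp (-ρ * t n) ≤ 1 := Real.exp_le_one_iff.2 (by nlinarith)
  set S := ∑ k ∈ Finset.range n, ∫ s in t k..t (k + 1),
        (deriv v s - (v (t (k + 1)) - v (t k)) / (t (k + 1) - t k)) * (t n - s) ^ (-α)
  have hS : |S| ≤ _ := Finset.abs_sum_le_sum_abs _ _
  have htα : 0 ≤ t n ^ α := Real.rpow_nonneg htn.le α
  calc _ = Real.exp (-ρ * t n) * (t n ^ α * |S|) := by field_simp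
    _ ≤ 1 * (t n ^ α * |S|) := mul_le_mul_of_nonneg_right hexp (by positivity)
    _ ≤ t n ^ α * _ := by rw [one_mul]; exact mul_le_mul_of_nonneg_left hS htα
    _ ≤ _ := key

/-! ### Regularity of the untempered function -/

/-- On a bounded time interval the bounds for lower derivatives are absorbed by the most singular
power. `j ≥ 1` makes `j - α` nonnegative, so that the constant `1` is absorbed too. -/
lemma one_add_rpow_le {α s T : ℝ} (hα0 : 0 < α) (hα1 : α < 1) (hs : s ∈ Ioo 0 T) {m j : ℕ}
    (hmj : m ≤ j) (hj1 : 1 ≤ j) (hj2 : j ≤ 2) :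
    1 + s ^ (α - (m : ℝ)) ≤ 2 * (1 + T) ^ 2 * s ^ (α - (j : ℝ)) := by
  have hs0 := hs.1
  have hT : 0 < T := hs0.trans hs.2
  have hj1' : (1 : ℝ) ≤ j := by exact_mod_cast hj1
  have hj2' : (j : ℝ) ≤ 2 := by exact_mod_cast hj2
  have hmj' : (m : ℝ) ≤ j := by exact_mod_cast hmj
  have hm0 : (0 : ℝ) ≤ m := m.cast_nonneg
  have hpow : ∀ p : ℝ, 0 ≤ p → p ≤ 2 → s ^ p ≤ (1 + T) ^ 2 := fun p hp0 hp2 => by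
    calc s ^ p ≤ (1 + T) ^ p := Real.rpow_le_rpow hs0.le (by linarith [hs.2]) hp0
      _ ≤ (1 + T) ^ (2 : ℝ) := Real.rpow_le_rpow_of_exponent_le (by linarith) hp2
      _ = _ := by norm_cast
  have h1 : (1 : ℝ) = s ^ ((j : ℝ) - α) * s ^ (α - (j : ℝ)) := by
    rw [← Real.rpow_add hs0]; simp
  have h2 : s ^ (α - (m : ℝ)) = s ^ ((j : ℝ) - m) * s ^ (α - (j : ℝ)) := by
    rw [← Real.rpow_add hs0]; ring_nf
  have h3 : 0 ≤ s ^ (α - (j : ℝ)) := by positivity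
  have h4 := mul_le_mul_of_nonneg_right (hpow (j - α) (by linarith) (by linarith)) h3
  have h5 := mul_le_mul_of_nonneg_right (hpow (j - m) (by linarith) (by linarith)) h3
  rw [← h1] at h4
  rw [← h2] at h5
  linarith

lemma hasDerivAt_exp_mul {ρ s w' : ℝ} {w : ℝ → ℝ} (h : HasDerivAt w w' s) :
    HasDerivAt (fun s => Real.exp (ρ * s) * w s) (Real.exp (ρ * s) * (ρ * w s + w')) s := by
  have := (((hasDerivAt_id s).const_mul ρ).exp).mul h
  refine this.congr_deriv ?_
  simp only [id]
  ring

/-- Regularity of `e^{ρs} w(s)` from the weakly singular regularity of `w`. -/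
lemma exp_mul_regularity {α ρ T K : ℝ} (hα0 : 0 < α) (hα1 : α < 1) (hρ : 0 ≤ ρ) (hK : 0 ≤ K)
    {w : ℝ → ℝ} (hw : ContDiffOn ℝ 2 w (Ioo 0 T))
    (hb : ∀ s ∈ Ioo 0 T, ∀ m : ℕ, m ≤ 2 → |iteratedDeriv m w s| ≤ K * (1 + s ^ (α - (m : ℝ))))
    {v : ℝ → ℝ} (hv : v = fun s => Real.exp (ρ * s) * w s) {A : ℝ}
    (hA : A = Real.exp (ρ * T) * (1 + ρ) ^ 2 * (2 * (1 + T) ^ 2) * K) :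
    DifferentiableOn ℝ v (Ioo 0 T) ∧ DifferentiableOn ℝ (deriv v) (Ioo 0 T) ∧
      (∀ s ∈ Ioo 0 T, |deriv v s| ≤ A * s ^ (α - 1)) ∧
      ∀ s ∈ Ioo 0 T, |deriv (deriv v) s| ≤ A * s ^ (α - 2) := by
  have hw0 : ∀ s ∈ Ioo 0 T, HasDerivAt w (iteratedDeriv 1 w s) s := fun s hs => by
    simpa using hasDerivAt_iteratedDeriv_of_contDiffOn isOpen_Ioo hw (m := 0) (by norm_num) hs
  have hw1 : ∀ s ∈ Ioo 0 T, HasDerivAt (iteratedDeriv 1 w) (iteratedDeriv 2 w s) s := fun s hs =>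
    hasDerivAt_iteratedDeriv_of_contDiffOn isOpen_Ioo hw (m := 1) (by norm_num) hs
  have hv0 : ∀ s ∈ Ioo 0 T,
      HasDerivAt v (Real.exp (ρ * s) * (ρ * w s + iteratedDeriv 1 w s)) s := fun s hs => by
    rw [hv]; exact hasDerivAt_exp_mul (hw0 s hs)
  have hv1 : ∀ s ∈ Ioo 0 T, HasDerivAt (deriv v)
      (Real.exp (ρ * s) * (ρ ^ 2 * w s + 2 * ρ * iteratedDeriv 1 w s + iteratedDeriv 2 w s)) s := by
    intro s hs
    have h := hasDerivAt_exp_mul (ρ := ρ) (((hw0 s hs).const_mul ρ).add (hw1 s hs))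
    refine (h.congr_of_eventuallyEq ?_).congr_deriv ?_
    · filter_upwards [Ioo_mem_nhds hs.1 hs.2] with y hy
      exact (hv0 y hy).deriv
    · simp only [Pi.add_apply]
      ring
  have hexp : ∀ s ∈ Ioo 0 T, Real.exp (ρ * s) ≤ Real.exp (ρ * T) := fun s hs =>
    Real.exp_le_exp.2 (mul_le_mul_of_nonneg_left hs.2.le hρ)
  have hbj : ∀ s ∈ Ioo 0 T, ∀ m j : ℕ, m ≤ j → 1 ≤ j → j ≤ 2 →
      |iteratedDeriv m w s| ≤ K * (2 * (1 + T) ^ 2 * s ^ (α - (j : ℝ))) :=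
    fun s hs m j hmj hj1 hj2 => (hb s hs m (hmj.trans hj2)).trans
      (mul_le_mul_of_nonneg_left (one_add_rpow_le hα0 hα1 hs hmj hj1 hj2) hK)
  refine ⟨fun s hs => (hv0 s hs).differentiableAt.differentiableWithinAt,
    fun s hs => (hv1 s hs).differentiableAt.differentiableWithinAt, fun s hs => ?_, fun s hs => ?_⟩
  · have b0 := hbj s hs 0 1 (by norm_num) le_rfl (by norm_num)
    have b1 := hbj s hs 1 1 le_rfl le_rfl (by norm_num)
    rw [iteratedDeriv_zero] at b0
    push_cast at b0 b1
    set X := K * (2 * (1 + T) ^ 2 * s ^ (α - 1)) with hX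
    have hX0 : 0 ≤ X := (abs_nonneg _).trans b0
    rw [(hv0 s hs).deriv, abs_mul, abs_of_pos (Real.exp_pos _)]
    calc _ ≤ Real.exp (ρ * T) * (ρ * X + X) := by
          refine mul_le_mul (hexp s hs) ((abs_add_le _ _).trans (add_le_add ?_ b1))
            (abs_nonneg _) (Real.exp_pos _).le
          rw [abs_mul, abs_of_nonneg hρ]
          exact mul_le_mul_of_nonneg_left b0 hρ
      _ ≤ Real.exp (ρ * T) * ((1 + ρ) ^ 2 * X) := by
          refine mul_le_mul_of_nonneg_left ?_ (Real.exp_pos _).le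
          nlinarith [mul_nonneg hρ hX0, mul_nonneg (mul_nonneg hρ hρ) hX0]
      _ = _ := by rw [hA, hX]; ring
  · have b0 := hbj s hs 0 2 (by norm_num) (by norm_num) le_rfl
    have b1 := hbj s hs 1 2 (by norm_num) (by norm_num) le_rfl
    have b2 := hbj s hs 2 2 le_rfl (by norm_num) le_rfl
    rw [iteratedDeriv_zero] at b0
    push_cast at b0 b1 b2
    set X := K * (2 * (1 + T) ^ 2 * s ^ (α - 2)) with hX
    rw [(hv1 s hs).deriv, abs_mul, abs_of_pos (Real.exp_pos _)]
    calc _ ≤ Real.exp (ρ * T) * (ρ ^ 2 * X + 2 * ρ * X + X) := by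
          refine mul_le_mul (hexp s hs) ((abs_add_three _ _ _).trans
            (add_le_add (add_le_add ?_ ?_) b2)) (abs_nonneg _) (Real.exp_pos _).le
          · rw [abs_mul, abs_of_nonneg (by positivity)]
            exact mul_le_mul_of_nonneg_left b0 (by positivity)
          · rw [abs_mul, abs_of_nonneg (by positivity)]
            exact mul_le_mul_of_nonneg_left b1 (by positivity)
      _ = _ := by rw [hA, hX]; ring

end TemperedDiffusion

/-! ### The error estimate -/

open TemperedDiffusion in
/-- The norm is the maximum norm over the spatial nodes `i = 0, …, M`. -/
theorem theorem4p2 (α ρ D l T r K : ℝ) (hα0 : 0 < α) (hα1 : α < 1) (hρ : 0 ≤ ρ) (hD : 0 < D)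
    (hl : 0 < l) (hT : 0 < T) (hr : 1 ≤ r) :
    ∃ C : ℝ, 0 < C ∧
      ∀ (f : ℝ → ℝ → ℝ) (ψ : ℝ → ℝ) (u : ℝ → ℝ → ℝ),
        TemperedDiffusion.IsSolution α ρ D l T f ψ u →
        TemperedDiffusion.HasRegularity α l T K u →
        ∀ (M N : ℕ), 1 ≤ M → 1 ≤ N →
        ∀ U : ℕ → ℕ → ℝ, TemperedDiffusion.IsSchemeSolution α ρ D l T r M N f ψ U →
        ∀ n : ℕ, n ≤ N →
          ‖(fun i : Fin (M + 1) =>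
              u (TemperedDiffusion.uniformMesh l M i) (TemperedDiffusion.gradedMesh T r N n)
                - U n i)‖
            ≤ C * ((l / (M : ℝ)) ^ 2 + T ^ α * (N : ℝ) ^ (-(min (2 - α) (r * α)))) := by
  have hΓ : 0 < Real.Gamma (1 - α) := Real.Gamma_pos_of_pos (by linarith)
  have hα' : 0 < 1 - α := by linarith
  set A := Real.exp (ρ * T) * (1 + ρ) ^ 2 * (2 * (1 + T) ^ 2) * |K| with hA
  set C₁ := 3 / (α * (1 - α)) + (r * 2 ^ r) ^ 2 * (5 + 2 / (1 - α)) with hC₁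
  set C₂ := Real.Gamma (1 - α) * T ^ α * (D * (2 * |K|)) with hC₂
  have hA0 : 0 ≤ A := by positivity
  have hC₁0 : 0 ≤ C₁ := by positivity
  have hC₂0 : 0 ≤ C₂ := by positivity
  -- The constant is chosen before any solution is given, so the sign of `K` is still unknown: hence
  -- `|K|`. The `1` ensures positivity.
  refine ⟨A * C₁ + C₂ + 1, by positivity, ?_⟩
  intro f ψ u hu hreg M N hM hN U hU n hn
  have hK : 0 ≤ K := (abs_nonneg _).trans
    (hreg.bound_space (l / 2) ⟨by linarith, by linarith⟩ T ⟨hT, le_rfl⟩)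
  rw [abs_of_nonneg hK] at hA hC₂
  set β := min (2 - α) (r * α)
  set t := gradedMesh T r N with ht
  set η := T ^ α * (N : ℝ) ^ (-β) with hη
  have hη0 : 0 ≤ η := by positivity
  have hmono : StrictMono t := strictMono_gradedMesh hT hr hN
  have ht0 : t 0 = 0 := gradedMesh_zero hr N
  have htmem : ∀ k, 1 ≤ k → k ≤ N → t k ∈ Ioc 0 T := fun k hk hkN =>
    ⟨ht0 ▸ hmono hk, (hmono.monotone hkN).trans_eq (gradedMesh_self hN)⟩
  have hM0 : (M : ℝ) ≠ 0 := by exact_mod_cast (by omega : M ≠ 0)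
  have hx0 : uniformMesh l M 0 = 0 := by simp [uniformMesh]
  have hxM : uniformMesh l M M = l := by unfold uniformMesh; field_simp
  -- Residual of the exact solution in the scheme: temporal plus spatial truncation error.
  set R : ℕ → ℕ → ℝ := fun n i =>
    (temperedL1 α ρ t (fun k => u (uniformMesh l M i) (t k)) n
      - caputoTempered α ρ (fun s => u (uniformMesh l M i) s) (t n))
    + D * (iteratedDeriv 2 (fun y => u y (t n)) (uniformMesh l M i)
      - centralDiff (l / (M : ℝ)) (fun j => u (uniformMesh l M j) (t n)) i) with hR
  have hRt : ∀ n i, 1 ≤ n → n ≤ N → 1 ≤ i → i + 1 ≤ M → Real.Gamma (1 - α) * (t n ^ α *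
      |temperedL1 α ρ t (fun k => u (uniformMesh l M i) (t k)) n
        - caputoTempered α ρ (fun s => u (uniformMesh l M i) s) (t n)|) ≤ A * C₁ * η := by
    intro n i hn hnN hi hiM
    have hx := uniformMesh_mem_Ioo hl hi hiM
    obtain ⟨h1, h2, h3, h4⟩ := exp_mul_regularity hα0 hα1 hρ hK (hreg.contDiffOn_time _ hx)
      (hreg.bound_time _ hx) rfl hA
    exact abs_temperedL1_sub_caputoTempered_le hα0 hα1 hρ hA0 hT hr (min_le_right _ _)
      (min_le_left _ _) (w := fun s => u (uniformMesh l M i) s) rfl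
      (ContinuousOn.mul (by fun_prop) (hu.continuousOn_time _ hx)) h1 h2 h3 h4 hn hnN
  have hRx : ∀ n i, 1 ≤ n → n ≤ N → 1 ≤ i → i + 1 ≤ M →
      |iteratedDeriv 2 (fun y => u y (t n)) (uniformMesh l M i)
        - centralDiff (l / (M : ℝ)) (fun j => u (uniformMesh l M j) (t n)) i|
        ≤ 2 * K * (l / M) ^ 2 := fun n i hn hnN hi hiM =>
    abs_iteratedDeriv_two_sub_centralDiff_le hl hK (hu.continuousOn_space _ (htmem n hn hnN))
      (hreg.contDiffOn_space _ (htmem n hn hnN))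
      (fun y hy => hreg.bound_space y hy _ (htmem n hn hnN)) hi hiM
  have hstab := scheme_stability (e := fun n i => u (uniformMesh l M i) (t n) - U n i) (R := R)
    (M := M) (N := N) (h := l / (M : ℝ)) (B := A * C₁ * η + C₂ * (l / M) ^ 2)
    -- The temporal part blows up like `t n ^ (-α)`, exactly what stability tolerates; for the
    -- spatial part `t n ^ α ≤ T ^ α` is used.
    (G := fun n => A * C₁ * η / (Real.Gamma (1 - α) * t n ^ α) + D * (2 * K * (l / M) ^ 2))
    hα0 hα1 hρ hD hmono ht0 (by positivity)
    (fun n i hn hnN hi hiM => by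
      have e1 := hu.equation _ (uniformMesh_mem_Ioo hl hi hiM) _ (htmem n hn hnN)
      have e2 := hU.equation n i hn hnN hi hiM
      rw [temperedL1_sub α ρ t (fun k => u (uniformMesh l M i) (t k)) (fun k => U k i), e2]
      simp only [hR, e1, centralDiff]
      ring)
    (fun n hn hnN => by
      rw [hx0, hu.boundary_left _ (htmem n hn hnN), hU.boundary_left n hn hnN, sub_zero])
    (fun n hn hnN => by
      rw [hxM, hu.boundary_right _ (htmem n hn hnN), hU.boundary_right n hn hnN, sub_zero])
    (fun i hi => by
      rw [ht0, hu.initial _ (uniformMesh_mem_Icc hl hM hi), hU.initial i hi, sub_self])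
    (fun n i hn hnN hi hiM => by
      have hp : 0 < Real.Gamma (1 - α) * t n ^ α :=
        mul_pos hΓ (Real.rpow_pos_of_pos (htmem n hn hnN).1 _)
      refine (abs_add_le _ _).trans (add_le_add ?_ ?_)
      · rw [le_div_iff₀ hp]
        refine le_trans (le_of_eq ?_) (hRt n i hn hnN hi hiM)
        ring
      · rw [abs_mul, abs_of_pos hD]
        exact mul_le_mul_of_nonneg_left (hRx n i hn hnN hi hiM) hD.le)
    (fun n hn hnN => by
      have htn := htmem n hn hnN
      have hp : 0 < t n ^ α := Real.rpow_pos_of_pos htn.1 _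
      have hle : t n ^ α ≤ T ^ α := Real.rpow_le_rpow htn.1.le htn.2 hα0.le
      calc _ = A * C₁ * η + Real.Gamma (1 - α) * t n ^ α * (D * (2 * K)) * (l / M) ^ 2 := by
            field_simp
        _ ≤ A * C₁ * η + Real.Gamma (1 - α) * T ^ α * (D * (2 * K)) * (l / M) ^ 2 := by
            gcongr
        _ = _ := by rw [hC₂])
    n hn
  rw [pi_norm_le_iff_of_nonneg (by positivity)]
  intro i
  refine (hstab i (Nat.lt_succ_iff.1 i.2)).trans ?_
  nlinarith [mul_nonneg (mul_nonneg hA0 hC₁0) (sq_nonneg (l / (M : ℝ))), mul_nonneg hC₂0 hη0,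
    sq_nonneg (l / (M : ℝ))]
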